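/- Let $n\ge 0$ be an integer and let $c_0,c_1,c_2\in\mathbb R$. There is a constant $\kappa=\kappa(n,c_0,c_1,c_2)>0$ with the following property. Let $(X,g)$ be a complete, connected (possibly non-compact) smooth Riemannian manifold of dimension $n+1$, with volume element $dV$, hypersurface area element $dS$, Riemann tensor $Rm$ and scalar curvature $R$. Let $\Omega\subset X$ be an open set (not necessarily bounded) with smooth boundary, and let $\beta:\partial\Omega\to\mathbb R$ be smooth. For $\tau>0$ and smooth $f:\overline\Omega\to\mathbb R$ put $u=e^{-f}/(4\pi\tau)^{\frac{n+1}{2}}$, $$\mathcal W_\beta(\Omega,g,f,\tau)=\int_\Omega\bigl(\tau(|\nabla f|^2+R)+f-(n+1)\bigr)u\,dV+2\tau\int_{\partial\Omega}\beta u\,dS ,$$ $$\mathcal W_\beta(\Omega,f,\tau)=\int_\Omega\bigl(\tau|\nabla f|^2+f-(n+1)\bigr)u\,dV+2\tau\int_{\partial\Omega}\beta u\,dS ,$$ and let $\mu_\beta(\Omega,g,\tau)$ and $\mu_\beta(\Omega,\tau)$ be the infima (in the extended reals) of $\mathcal W_\beta(\Omega,g,f,\tau)$ and of $\mathcal W_\beta(\Omega,f,\tau)$,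 respectively, over all smooth $f:\overline\Omega\to\mathbb R$ for which $\int_\Omega u\,dV=1$ and each term $u$, $|\nabla f|^2u$, $fu$ (and $Ru$ in the first case) is integrable over $\Omega$ and $\beta u$ is integrable over $\partial\Omega$. Let $r>0$ and $x_0\in X$, write $B_s=B_s(x_0)$ for the open metric balls and $V$ for the volume. Suppose that $$\mu_\beta(\Omega,g,r^2)\ge -c_0\qquad\text{or}\qquad \mu_\beta(\Omega,r^2)\ge -c_0,$$ that $V(\Omega\cap B_{r/2})>0$, that $$\frac{V(\Omega\cap B_r)+r^2\int_{\partial\Omega\cap B_r}|\beta|\,dS}{V(\Omega\cap B_{r/2})}\le c_1,$$ and that $r^2|Rm|\le c_2$ in $\Omega\cap B_r$. Then $$\frac{V(\Omega\cap B_r)}{r^{n+1}}\ge\kappa .$$ -/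

import Mathlib

open Bundle MeasureTheory Manifold Topology
open scoped ContDiff ENNReal

noncomputable section

section Coordinates

variable {E : Type*} [NormedAddCommGroup E] [NormedSpace ℝ E]

/-- The Christoffel symbol `Γ(v, w)` at `y` of a metric `G` given in coordinates on a vector space:
the vector determined by
`2 G(Γ(v, w), z) = ∂_v G(w, z) + ∂_w G(v, z) - ∂_z G(v, w)` for all `z`.
It is `∇_v w` for the constant (coordinate) vector fields `v`, `w`. -/
def christoffel (G : E → E →L[ℝ] E →L[ℝ] ℝ) (y v w : E) : E :=
  (G y).inverse ((1 / 2 : ℝ) •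
    (fderiv ℝ G y v w + fderiv ℝ G y w v - ((fderiv ℝ G y).flip v).flip w))

/-- The Riemann curvature `R(u, v) w = ∇_u ∇_v w - ∇_v ∇_u w` at `y` of a metric `G` given in
coordinates, for constant vector fields `u`, `v`, `w`. -/
def coordCurvature (G : E → E →L[ℝ] E →L[ℝ] ℝ) (y u v w : E) : E :=
  fderiv ℝ (fun y' => christoffel G y' v w) y u - fderiv ℝ (fun y' => christoffel G y' u w) y v
    + christoffel G y u (christoffel G y v w) - christoffel G y v (christoffel G y u w)

end Coordinates

section Manifold

variable {n : ℕ} {X : Type*} [MetricSpace X] [ChartedSpace (EuclideanSpace ℝ (Fin (n + 1))) X]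
  [IsManifold (𝓡 (n + 1)) ∞ X]

instance tangentFiniteDimensional (p : X) :
    FiniteDimensional ℝ (TangentSpace (𝓡 (n + 1)) p) :=
  inferInstanceAs (FiniteDimensional ℝ (EuclideanSpace ℝ (Fin (n + 1))))

section Metric

variable [RiemannianBundle (fun x : X => TangentSpace (𝓡 (n + 1)) x)]

/-- The Riemannian metric in the preferred chart around `p`, as a field of bilinear forms on the
model space: the pull-back of the metric under the inverse of the chart. -/
def chartMetric (p : X) (y : EuclideanSpace ℝ (Fin (n + 1))) :
    EuclideanSpace ℝ (Fin (n + 1)) →L[ℝ] EuclideanSpace ℝ (Fin (n + 1)) →L[ℝ] ℝ :=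
  (innerSL ℝ (E := TangentSpace (𝓡 (n + 1)) ((extChartAt (𝓡 (n + 1)) p).symm y))).bilinearComp
    (mfderiv 𝓘(ℝ, EuclideanSpace ℝ (Fin (n + 1))) (𝓡 (n + 1)) (extChartAt (𝓡 (n + 1)) p).symm y)
    (mfderiv 𝓘(ℝ, EuclideanSpace ℝ (Fin (n + 1))) (𝓡 (n + 1)) (extChartAt (𝓡 (n + 1)) p).symm y)

/-- The Riemann tensor `Rm(u, v, w, z) = g(R(u, v) w, z)` at `p`. -/
def riemannTensor (p : X) (u v w z : TangentSpace (𝓡 (n + 1)) p) : ℝ :=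
  let A : TangentSpace (𝓡 (n + 1)) p →L[ℝ] EuclideanSpace ℝ (Fin (n + 1)) :=
    mfderiv (𝓡 (n + 1)) 𝓘(ℝ, EuclideanSpace ℝ (Fin (n + 1))) (extChartAt (𝓡 (n + 1)) p) p
  let y := extChartAt (𝓡 (n + 1)) p p
  chartMetric p y (coordCurvature (chartMetric p) y (A u) (A v) (A w)) (A z)

variable (n) in
/-- The norm `|Rm| = (∑ Rm(eᵢ, eⱼ, eₖ, eₗ)²)^{1/2}` at `p`, for an orthonormal basis `e` of the
tangent space. -/
def riemannNorm (p : X) : ℝ :=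
  let e := stdOrthonormalBasis ℝ (TangentSpace (𝓡 (n + 1)) p)
  √(∑ i, ∑ j, ∑ k, ∑ l, riemannTensor p (e i) (e j) (e k) (e l) ^ 2)

variable (n) in
/-- The scalar curvature `R = ∑ Rm(eᵢ, eⱼ, eⱼ, eᵢ)` at `p`, for an orthonormal basis `e` of the
tangent space (positive on round spheres). -/
def scalarCurvature (p : X) : ℝ :=
  let e := stdOrthonormalBasis ℝ (TangentSpace (𝓡 (n + 1)) p)
  ∑ i, ∑ j, riemannTensor p (e i) (e j) (e j) (e i)

end Metric

variable (n) in
/-- The open set `Ω` has smooth boundary: near each boundary point it is the sublevel set `{ρ < 0}`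
of a smooth function `ρ` with nonvanishing differential. -/
def HasSmoothBoundary (Ω : Set X) : Prop :=
  ∀ p ∈ frontier Ω, ∃ U : Set X, IsOpen U ∧ p ∈ U ∧ ∃ ρ : X → ℝ,
    ContMDiffOn (𝓡 (n + 1)) 𝓘(ℝ, ℝ) ∞ ρ U ∧ ρ p = 0 ∧ mvfderiv (𝓡 (n + 1)) ρ p ≠ 0 ∧
      Ω ∩ U = {x ∈ U | ρ x < 0}

/-- `u = e^{-f} / (4πτ)^{(n+1)/2}`. -/
def entropyDensity (n : ℕ) {X : Type*} (f : X → ℝ) (τ : ℝ) (x : X) : ℝ :=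
  Real.exp (-f x) / (4 * Real.pi * τ) ^ (((n : ℝ) + 1) / 2)

variable [MeasurableSpace X] [BorelSpace X]

variable (n X) in
/-- The Riemannian volume `dV`: the `(n+1)`-dimensional Hausdorff measure of the Riemannian
distance, normalized to agree with Lebesgue measure on Euclidean space. -/
def riemannianVolume : Measure X := μHE[n + 1]

variable (n X) in
/-- The area element `dS` of hypersurfaces: the `n`-dimensional Hausdorff measure of the Riemannian
distance, normalized to agree with Lebesgue measure on `n`-dimensional Euclidean space. -/
def hypersurfaceArea : Measure X := μHE[n]

variable [RiemannianBundle (fun x : X => TangentSpace (𝓡 (n + 1)) x)]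

variable (n) in
/-- The functional
`∫_Ω (τ (|∇f|² + S) + f - (n + 1)) u dV + 2 τ ∫_{∂Ω} β u dS`.
With `S` the scalar curvature this is `𝓦_β(Ω, g, f, τ)`; with `S = 0` it is `𝓦_β(Ω, f, τ)`. -/
def entropyFunctional (S : X → ℝ) (Ω : Set X) (β f : X → ℝ) (τ : ℝ) : ℝ :=
  (∫ x in Ω, (τ * (‖mvfderiv (𝓡 (n + 1)) f x‖ ^ 2 + S x) + f x - ((n : ℝ) + 1)) *
      entropyDensity n f τ x ∂riemannianVolume n X)
    + 2 * τ * ∫ x in frontier Ω, β x * entropyDensity n f τ x ∂hypersurfaceArea n X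

/-- The functions over which the entropy is minimized: `f` smooth on the closure of `Ω` with
`∫_Ω u dV = 1`, such that every term of the functional is integrable (which is automatic when
`Ω` is bounded). Only the values of `f` on the closure of `Ω` matter. -/
structure IsAdmissible (n : ℕ) {X : Type*} [MetricSpace X]
    [ChartedSpace (EuclideanSpace ℝ (Fin (n + 1))) X] [IsManifold (𝓡 (n + 1)) ∞ X]
    [MeasurableSpace X] [BorelSpace X] [RiemannianBundle (fun x : X => TangentSpace (𝓡 (n + 1)) x)]
    (S : X → ℝ) (Ω : Set X) (β : X → ℝ) (τ : ℝ) (f : X → ℝ) : Prop where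
  smooth : ContMDiffOn (𝓡 (n + 1)) 𝓘(ℝ, ℝ) ∞ f (closure Ω)
  integrable_density : IntegrableOn (entropyDensity n f τ) Ω (riemannianVolume n X)
  integrable_gradient : IntegrableOn
    (fun x => ‖mvfderiv (𝓡 (n + 1)) f x‖ ^ 2 * entropyDensity n f τ x) Ω (riemannianVolume n X)
  integrable_curvature : IntegrableOn
    (fun x => S x * entropyDensity n f τ x) Ω (riemannianVolume n X)
  integrable_potential : IntegrableOn
    (fun x => f x * entropyDensity n f τ x) Ω (riemannianVolume n X)
  integrable_boundary : IntegrableOn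
    (fun x => β x * entropyDensity n f τ x) (frontier Ω) (hypersurfaceArea n X)
  normalized : ∫ x in Ω, entropyDensity n f τ x ∂riemannianVolume n X = 1

variable (n) in
/-- The infimum of the functional over all admissible `f`, as an extended real number. -/
def entropyInf (S : X → ℝ) (Ω : Set X) (β : X → ℝ) (τ : ℝ) : EReal :=
  ⨅ (f : X → ℝ) (_ : IsAdmissible n S Ω β τ f), (entropyFunctional n S Ω β f τ : EReal)

variable (n) in
/-- The entropy `μ_β(Ω, g, τ)`, with the scalar curvature term. -/
def muMetric (Ω : Set X) (β : X → ℝ) (τ : ℝ) : EReal :=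
  entropyInf n (scalarCurvature n) Ω β τ

variable (n) in
/-- The entropy `μ_β(Ω, τ)`, without the scalar curvature term. -/
def muFixed (Ω : Set X) (β : X → ℝ) (τ : ℝ) : EReal :=
  entropyInf n (fun _ => 0) Ω β τ

end Manifold

end

/-! Test the entropy at scale τ = r² on a density concentrated in the ball. With Z = ∫_Ω u and f =
-log (u/Z) - (n+1)/2 · log (4πτ), the functional becomes Z⁻¹ (τ∫|∇u|²/u + τ∫Su - ∫u log u + 2τ∫βu) +
log Z - (n+1)/2 · log (4πτ) - (n+1), where S is R or 0. If u were φ² for a cutoff φ that is 1 on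
B_{r/2}, vanishes off B_r and satisfies |∇φ| ≤ C/r, then V(Ω ∩ B_{r/2}) ≤ Z ≤ V(Ω ∩ B_r). The
bracket would be at most a constant times V(Ω ∩ B_r) + r²∫|β|, hence at most a constant times Z by
the ratio hypothesis. So the entropy is at most C + log (V(Ω ∩ B_r)/r^{n+1}), and comparison with
-c₀ gives κ. The bound on |Rm| enters only through |R|.

The obstacle is that f must be real-valued and smooth on a possibly unbounded closure, so u may not
vanish. The density used is u = φ² + s, where s > 0 is so small that its contribution to every
integral is negligible. Such an s is built from a partition of unity in
`exists_contMDiff_pos_small`. It requires volume and boundary area to be locally finite, and S and β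
to be locally bounded.

Continuity of R needs an argument, since Rm at q is defined in the preferred chart of q, which jumps
with q. The transformation law `IsMetricPullback.curvature_transform` moves everything to one fixed
chart. The cutoff is a function of a smooth approximation of the distance, given by
`exists_contMDiff_approx_of_lipschitz`. The estimates are gathered in `exists_test_function`, the
functional is evaluated in `entropyInf_le_of_test_function`, and `entropyInf_le` is the resulting
upper bound. -/

/-! ### Curvature of a metric in coordinates and its transformation law. -/

section CoordinateCurvature

set_option maxSynthPendingDepth 3

variable {E : Type*} [NormedAddCommGroup E] [NormedSpace ℝ E]

/-- The Christoffel symbol as a field of continuous bilinear maps. -/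
noncomputable def christoffelL (G : E → E →L[ℝ] E →L[ℝ] ℝ) (y : E) : E →L[ℝ] E →L[ℝ] E :=
  (ContinuousLinearMap.compL ℝ E (E →L[ℝ] ℝ) E (G y).inverse) ∘L
    ((1 / 2 : ℝ) • (fderiv ℝ G y + (fderiv ℝ G y).flip -
      ((ContinuousLinearMap.flipₗᵢ ℝ E E ℝ).toContinuousLinearEquiv.toContinuousLinearMap) ∘L
        (fderiv ℝ G y).flip))

theorem christoffelL_apply (G : E → E →L[ℝ] E →L[ℝ] ℝ) (y v w : E) :
    christoffelL G y v w = christoffel G y v w := by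
  simp [christoffelL, christoffel]

/-- The curvature in terms of the bilinear Christoffel symbols. -/
noncomputable def curvatureL (Γ : E → E →L[ℝ] E →L[ℝ] E) (y u v w : E) : E :=
  fderiv ℝ Γ y u v w - fderiv ℝ Γ y v u w + Γ y u (Γ y v w) - Γ y v (Γ y u w)

theorem coordCurvature_eq_curvatureL {G : E → E →L[ℝ] E →L[ℝ] ℝ} {y : E}
    (h : DifferentiableAt ℝ (christoffelL G) y) (u v w : E) :
    coordCurvature G y u v w = curvatureL (christoffelL G) y u v w := by
  have key : ∀ a b c : E, fderiv ℝ (fun y' => christoffel G y' a b) y c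
      = fderiv ℝ (christoffelL G) y c a b := by
    intro a b c
    have h1 : (fun y' => christoffel G y' a b) = fun y' => christoffelL G y' a b := by
      ext1 y'; rw [christoffelL_apply]
    have h2 : HasFDerivAt (fun y' => christoffelL G y' a b)
        ((fderiv ℝ (christoffelL G) y).flip a |>.flip b) y := by
      have := (h.hasFDerivAt.clm_apply (hasFDerivAt_const a y)).clm_apply (hasFDerivAt_const b y)
      convert this using 1
      ext z
      simp
    rw [h1, h2.fderiv]
    simp
  simp only [coordCurvature, curvatureL, key, christoffelL_apply]

theorem curvatureL_continuousOn {Γ : E → E →L[ℝ] E →L[ℝ] E} {O : Set E} (hO : IsOpen O)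
    (h : ContDiffOn ℝ ∞ Γ O) {u v w : E → E} (hu : ContinuousOn u O) (hv : ContinuousOn v O)
    (hw : ContinuousOn w O) : ContinuousOn (fun y => curvatureL Γ y (u y) (v y) (w y)) O := by
  have h1 : ContinuousOn (fderiv ℝ Γ) O := h.continuousOn_fderiv_of_isOpen hO (by simp)
  have h0 := h.continuousOn
  unfold curvatureL
  exact ((((h1.clm_apply hu).clm_apply hv).clm_apply hw).sub
    (((h1.clm_apply hv).clm_apply hu).clm_apply hw)).add
    ((h0.clm_apply hu).clm_apply ((h0.clm_apply hv).clm_apply hw)) |>.sub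
    ((h0.clm_apply hv).clm_apply ((h0.clm_apply hu).clm_apply hw))

theorem christoffelL_contDiffOn [CompleteSpace E] {G : E → E →L[ℝ] E →L[ℝ] ℝ} {O : Set E}
    (hO : IsOpen O)
    (hG : ContDiffOn ℝ ∞ G O) (hinv : ∀ y ∈ O, (G y).IsInvertible) :
    ContDiffOn ℝ ∞ (christoffelL G) O := by
  have h1 : ContDiffOn ℝ ∞ (fderiv ℝ G) O := hG.fderiv_of_isOpen hO (by simp)
  have h2 : ContDiffOn ℝ ∞ (fun y => (G y).inverse) O := by
    intro y hy
    exact (ContinuousLinearMap.IsInvertible.contDiffAt_map_inverse (hinv y hy)).comp_contDiffWithinAt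
      y (hG y hy)
  have hflip : ContDiffOn ℝ ∞ (fun y => (fderiv ℝ G y).flip) O :=
    (ContinuousLinearMap.flipₗᵢ ℝ E E (E →L[ℝ] ℝ)).contDiff.comp_contDiffOn h1
  unfold christoffelL
  refine ContDiffOn.clm_comp ?_ ?_
  · exact (ContinuousLinearMap.contDiff _).comp_contDiffOn h2
  · exact ((h1.add hflip).sub (contDiffOn_const.clm_comp hflip)).const_smul (1 / 2 : ℝ)

/-- The Koszul formula for coordinate fields; later arguments use only this, not the inverse of the
metric. -/
theorem christoffel_pairing {G : E → E →L[ℝ] E →L[ℝ] ℝ} {y : E} (hinv : (G y).IsInvertible)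
    (v w z : E) : G y (christoffelL G y v w) z
      = (1 / 2) * (fderiv ℝ G y v w z + fderiv ℝ G y w v z - fderiv ℝ G y z v w) := by
  obtain ⟨e, he⟩ := hinv
  rw [christoffelL_apply, christoffel, ← he, ContinuousLinearMap.inverse_equiv]
  simp

/-- The data of a change of coordinates `Ψ` from `O'` to `O` which pulls back the metric `G`
to the metric `G'`. -/
structure IsMetricPullback (G G' : E → E →L[ℝ] E →L[ℝ] ℝ) (Ψ : E → E) (O O' : Set E) : Prop where
  isOpen : IsOpen O
  isOpen' : IsOpen O'
  mapsTo : Set.MapsTo Ψ O' O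
  smooth : ContDiffOn ℝ ∞ Ψ O'
  metric_smooth : ContDiffOn ℝ ∞ G O
  metric_smooth' : ContDiffOn ℝ ∞ G' O'
  metric_symm : ∀ y ∈ O, ∀ v w, G y v w = G y w v
  invertible : ∀ y ∈ O, (G y).IsInvertible
  invertible' : ∀ y ∈ O', (G' y).IsInvertible
  surjective : ∀ y ∈ O', Function.Surjective (fderiv ℝ Ψ y)
  pullback : ∀ y ∈ O', ∀ v w, G' y v w = G (Ψ y) (fderiv ℝ Ψ y v) (fderiv ℝ Ψ y w)

namespace IsMetricPullback

variable {G G' : E → E →L[ℝ] E →L[ℝ] ℝ} {Ψ : E → E} {O O' : Set E}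

theorem hasFDerivAt (h : IsMetricPullback G G' Ψ O O') {y : E} (hy : y ∈ O') :
    HasFDerivAt Ψ (fderiv ℝ Ψ y) y :=
  ((h.smooth.contDiffAt (h.isOpen'.mem_nhds hy)).differentiableAt (by simp)).hasFDerivAt

theorem contDiffOn_fderiv (h : IsMetricPullback G G' Ψ O O') : ContDiffOn ℝ ∞ (fderiv ℝ Ψ) O' :=
  h.smooth.fderiv_of_isOpen h.isOpen' (by simp)

theorem hasFDerivAt_fderiv (h : IsMetricPullback G G' Ψ O O') {y : E} (hy : y ∈ O') :
    HasFDerivAt (fderiv ℝ Ψ) (fderiv ℝ (fderiv ℝ Ψ) y) y :=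
  ((h.contDiffOn_fderiv.contDiffAt (h.isOpen'.mem_nhds hy)).differentiableAt
    (by simp)).hasFDerivAt

theorem hessian_symm (h : IsMetricPullback G G' Ψ O O') {y : E} (hy : y ∈ O') (v w : E) :
    fderiv ℝ (fderiv ℝ Ψ) y v w = fderiv ℝ (fderiv ℝ Ψ) y w v :=
  (h.smooth.contDiffAt (h.isOpen'.mem_nhds hy)).isSymmSndFDerivAt
    (by rw [minSmoothness_of_isRCLikeNormedField]; exact ENat.LEInfty.out) v w

theorem third_symm (h : IsMetricPullback G G' Ψ O O') {y : E} (hy : y ∈ O') (u v : E) :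
    fderiv ℝ (fderiv ℝ (fderiv ℝ Ψ)) y u v = fderiv ℝ (fderiv ℝ (fderiv ℝ Ψ)) y v u :=
  (h.contDiffOn_fderiv.contDiffAt (h.isOpen'.mem_nhds hy)).isSymmSndFDerivAt
    (by rw [minSmoothness_of_isRCLikeNormedField]; exact ENat.LEInfty.out) u v

theorem fderiv_metric (h : IsMetricPullback G G' Ψ O O') {y : E} (hy : y ∈ O') (u v w : E) :
    fderiv ℝ G' y u v w = fderiv ℝ G (Ψ y) (fderiv ℝ Ψ y u) (fderiv ℝ Ψ y v) (fderiv ℝ Ψ y w)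
      + G (Ψ y) (fderiv ℝ (fderiv ℝ Ψ) y u v) (fderiv ℝ Ψ y w)
      + G (Ψ y) (fderiv ℝ Ψ y v) (fderiv ℝ (fderiv ℝ Ψ) y u w) := by
  have hG : HasFDerivAt G (fderiv ℝ G (Ψ y)) (Ψ y) :=
    ((h.metric_smooth.contDiffAt (h.isOpen.mem_nhds (h.mapsTo hy))).differentiableAt
      (by simp)).hasFDerivAt
  have hG' : HasFDerivAt G' (fderiv ℝ G' y) y :=
    ((h.metric_smooth'.contDiffAt (h.isOpen'.mem_nhds hy)).differentiableAt
      (by simp)).hasFDerivAt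
  have hc := hG.comp y (h.hasFDerivAt hy)
  have hv := (h.hasFDerivAt_fderiv hy).clm_apply (hasFDerivAt_const v y)
  have hw := (h.hasFDerivAt_fderiv hy).clm_apply (hasFDerivAt_const w y)
  have h1 := (hc.clm_apply hv).clm_apply hw
  have h2 := (hG'.clm_apply (hasFDerivAt_const v y)).clm_apply (hasFDerivAt_const w y)
  have h3 := h1.congr_of_eventuallyEq (f₁ := fun y => G' y v w)
    (Filter.eventually_of_mem (h.isOpen'.mem_nhds hy) fun z hz => h.pullback z hz v w)
  have := congrArg (fun L => L u) (h2.unique h3)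
  simp at this
  rw [this]
  ring

/-- By nondegeneracy of `G` and surjectivity of dΨ it suffices to pair both sides with dΨ z.
Inserting `fderiv_metric` three times in the Koszul formula, the Hessian terms cancel by symmetry
except G(D²Ψ(v, w), dΨ z), which occurs twice. -/
theorem christoffel_transform (h : IsMetricPullback G G' Ψ O O') {y : E} (hy : y ∈ O')
    (v w : E) : fderiv ℝ Ψ y (christoffelL G' y v w)
      = fderiv ℝ (fderiv ℝ Ψ) y v w
        + christoffelL G (Ψ y) (fderiv ℝ Ψ y v) (fderiv ℝ Ψ y w) := by
  have hi := h.invertible _ (h.mapsTo hy)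
  have hinj : Function.Injective (G (Ψ y)) := by
    obtain ⟨e, he⟩ := hi
    rw [← he]; exact e.injective
  apply hinj
  ext z'
  obtain ⟨z, rfl⟩ := h.surjective y hy z'
  have h1 := christoffel_pairing (h.invertible' y hy) v w z
  rw [h.pullback y hy, h.fderiv_metric hy, h.fderiv_metric hy, h.fderiv_metric hy] at h1
  have h2 := christoffel_pairing hi (fderiv ℝ Ψ y v) (fderiv ℝ Ψ y w) (fderiv ℝ Ψ y z)
  have s1 := h.hessian_symm hy w v
  have s2 := h.hessian_symm hy z v
  have s3 := h.hessian_symm hy z w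
  have s4 := h.metric_symm _ (h.mapsTo hy) (fderiv ℝ Ψ y w) (fderiv ℝ (fderiv ℝ Ψ) y v z)
  rw [h1, map_add, add_apply, h2, s1, s2, s3, s4]
  ring

variable [CompleteSpace E]

/-- Differentiate the Christoffel law and antisymmetrize in `u`, `v`. Third derivatives of Ψ cancel
by symmetry; the Hessian terms cancel by symmetry or against those produced by the quadratic part of
the curvature. -/
theorem curvature_transform (h : IsMetricPullback G G' Ψ O O') {y : E} (hy : y ∈ O')
    (u v w : E) : fderiv ℝ Ψ y (curvatureL (christoffelL G') y u v w)
      = curvatureL (christoffelL G) (Ψ y) (fderiv ℝ Ψ y u) (fderiv ℝ Ψ y v) (fderiv ℝ Ψ y w) := by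
  have hΓ : HasFDerivAt (christoffelL G) (fderiv ℝ (christoffelL G) (Ψ y)) (Ψ y) :=
    (((christoffelL_contDiffOn h.isOpen h.metric_smooth h.invertible).contDiffAt
      (h.isOpen.mem_nhds (h.mapsTo hy))).differentiableAt (by simp)).hasFDerivAt
  have hΓ' : HasFDerivAt (christoffelL G') (fderiv ℝ (christoffelL G') y) y :=
    (((christoffelL_contDiffOn h.isOpen' h.metric_smooth' h.invertible').contDiffAt
      (h.isOpen'.mem_nhds hy)).differentiableAt (by simp)).hasFDerivAt
  have hH : HasFDerivAt (fderiv ℝ (fderiv ℝ Ψ)) (fderiv ℝ (fderiv ℝ (fderiv ℝ Ψ)) y) y :=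
    (((h.contDiffOn_fderiv.fderiv_of_isOpen (m := ∞) h.isOpen' (by simp)).contDiffAt
      (h.isOpen'.mem_nhds hy)).differentiableAt (by simp)).hasFDerivAt
  have hc := hΓ.comp y (h.hasFDerivAt hy)
  have key : ∀ a b c : E,
      fderiv ℝ (fderiv ℝ Ψ) y a (christoffelL G' y b c)
        + fderiv ℝ Ψ y (fderiv ℝ (christoffelL G') y a b c)
      = fderiv ℝ (fderiv ℝ (fderiv ℝ Ψ)) y a b c
        + (fderiv ℝ (christoffelL G) (Ψ y) (fderiv ℝ Ψ y a) (fderiv ℝ Ψ y b) (fderiv ℝ Ψ y c)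
          + christoffelL G (Ψ y) (fderiv ℝ (fderiv ℝ Ψ) y a b) (fderiv ℝ Ψ y c)
          + christoffelL G (Ψ y) (fderiv ℝ Ψ y b) (fderiv ℝ (fderiv ℝ Ψ) y a c)) := by
    intro a b c
    have hb := (h.hasFDerivAt_fderiv hy).clm_apply (hasFDerivAt_const b y)
    have hcc := (h.hasFDerivAt_fderiv hy).clm_apply (hasFDerivAt_const c y)
    have l1 := (h.hasFDerivAt_fderiv hy).clm_apply
      ((hΓ'.clm_apply (hasFDerivAt_const b y)).clm_apply (hasFDerivAt_const c y))
    have r1 := ((hH.clm_apply (hasFDerivAt_const b y)).clm_apply (hasFDerivAt_const c y)).add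
      ((hc.clm_apply hb).clm_apply hcc)
    have h3 := r1.congr_of_eventuallyEq
      (f₁ := fun y => fderiv ℝ Ψ y (christoffelL G' y b c))
      (Filter.eventually_of_mem (h.isOpen'.mem_nhds hy)
        fun z hz => h.christoffel_transform hz b c)
    have := congrArg (fun L => L a) (l1.unique h3)
    simp at this
    rw [add_comm] at this
    rw [this]
    abel
  have k1 := eq_sub_of_add_eq' (key u v w)
  have k2 := eq_sub_of_add_eq' (key v u w)
  simp only [curvatureL, map_add, map_sub]
  rw [k1, k2, h.christoffel_transform hy u, h.christoffel_transform hy v,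
    h.christoffel_transform hy v, h.christoffel_transform hy u w, h.third_symm hy v u,
    h.hessian_symm hy v u]
  simp only [map_add]
  abel

end IsMetricPullback

/-- The trace identity ∑ T(eᵢ, eᵢ) = g^{ab} T_{ab}. It trades an orthonormal basis, chosen
separately at each point, for a fixed basis and the inverse metric, which vary continuously. -/
theorem sum_orthonormal_eq_sum_basis {ι κ : Type*} [Fintype ι] [Fintype κ]
    {g : E →L[ℝ] E →L[ℝ] ℝ} (hinv : g.IsInvertible) {e : κ → E}
    (he : ∀ z, z = ∑ i, g (e i) z • e i) (b : Module.Basis ι ℝ E) {β : ι → E →L[ℝ] ℝ}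
    (hβ : ∀ a z, β a z = b.repr z a) (T : E →ₗ[ℝ] E →ₗ[ℝ] ℝ) :
    ∑ i, T (e i) (e i) = ∑ a, T (g.inverse (β a)) (b a) := by
  have h1 : ∀ a, g.inverse (β a) = ∑ i, β a (e i) • e i := by
    intro a
    obtain ⟨L, rfl⟩ := hinv
    rw [ContinuousLinearMap.inverse_equiv]
    apply L.injective
    ext z
    have h2 := congrArg (β a) (he z)
    simp only [map_sum, map_smul, smul_eq_mul, ContinuousLinearEquiv.coe_coe] at h2
    simp [h2, mul_comm]
  simp only [h1, map_sum, LinearMap.sum_apply, map_smul, LinearMap.smul_apply]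
  rw [Finset.sum_comm]
  refine Finset.sum_congr rfl fun i _ => ?_
  conv_lhs => enter [2]; rw [← b.sum_repr (e i)]
  simp [hβ, -Module.Basis.sum_repr]

/-- The scalar curvature of a metric in coordinates, with respect to an arbitrary basis. -/
noncomputable def coordScalar {ι : Type*} [Fintype ι] (b : Module.Basis ι ℝ E)
    (β : ι → E →L[ℝ] ℝ) (G : E → E →L[ℝ] E →L[ℝ] ℝ) (y : E) : ℝ :=
  ∑ a, ∑ c, G y (curvatureL (christoffelL G) y ((G y).inverse (β a)) (b c)
    ((G y).inverse (β c))) (b a)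

/-- Two applications of the trace identity, one for each contraction of the curvature tensor. -/
theorem coordScalar_eq {ι κ : Type*} [Fintype ι] [Fintype κ]
    {G : E → E →L[ℝ] E →L[ℝ] ℝ} {y : E} (hinv : (G y).IsInvertible) {e : κ → E}
    (he : ∀ z, z = ∑ i, G y (e i) z • e i) (b : Module.Basis ι ℝ E) {β : ι → E →L[ℝ] ℝ}
    (hβ : ∀ a z, β a z = b.repr z a) :
    ∑ i, ∑ j, G y (curvatureL (christoffelL G) y (e i) (e j) (e j)) (e i)
      = coordScalar b β G y := by
  have h1 := sum_orthonormal_eq_sum_basis hinv he b hβ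
    (LinearMap.mk₂ ℝ (fun x z => ∑ j, G y (curvatureL (christoffelL G) y x (e j) (e j)) z)
      (by intro x x' z; simp only [curvatureL, map_add, map_sub, add_apply, sub_apply,
            ← Finset.sum_add_distrib]; congr! 1; ring)
      (by intro c x z; simp only [curvatureL, map_add, map_sub, add_apply, sub_apply,
            map_smul, smul_apply, smul_eq_mul, Finset.mul_sum]; congr! 1; ring)
      (by intro x z z'; simp only [map_add, ← Finset.sum_add_distrib])
      (by intro c x z; simp only [map_smul, smul_eq_mul, Finset.mul_sum]))
  simp only [LinearMap.mk₂_apply] at h1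
  rw [h1, coordScalar]
  refine Finset.sum_congr rfl fun a _ => ?_
  have h2 := sum_orthonormal_eq_sum_basis hinv he b hβ
    (LinearMap.mk₂ ℝ (fun x z =>
        G y (curvatureL (christoffelL G) y ((G y).inverse (β a)) z x) (b a))
      (by intro x x' z; simp only [curvatureL, map_add, map_sub, add_apply, sub_apply]; ring)
      (by intro c x z; simp only [curvatureL, map_add, map_sub, add_apply, sub_apply,
            map_smul, smul_apply, smul_eq_mul]; ring)
      (by intro x x' z; simp only [curvatureL, map_add, map_sub, add_apply, sub_apply]; ring)
      (by intro c x z; simp only [curvatureL, map_add, map_sub, add_apply, sub_apply,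
            map_smul, smul_apply, smul_eq_mul]; ring))
  simpa only [LinearMap.mk₂_apply] using h2

theorem coordScalar_continuousOn [CompleteSpace E] {ι : Type*} [Fintype ι]
    (b : Module.Basis ι ℝ E)
    (β : ι → E →L[ℝ] ℝ) {G : E → E →L[ℝ] E →L[ℝ] ℝ} {O : Set E} (hO : IsOpen O)
    (hG : ContDiffOn ℝ ∞ G O) (hinv : ∀ y ∈ O, (G y).IsInvertible) :
    ContinuousOn (coordScalar b β G) O := by
  have hi : ContinuousOn (fun y => (G y).inverse) O := by
    intro y hy
    exact (ContinuousLinearMap.IsInvertible.contDiffAt_map_inverse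
      (n := 0) (hinv y hy)).continuousAt.comp_continuousWithinAt (hG.continuousOn y hy)
  unfold coordScalar
  refine continuousOn_finsetSum _ fun a _ => continuousOn_finsetSum _ fun c _ => ?_
  exact (hG.continuousOn.clm_apply (curvatureL_continuousOn hO
    (christoffelL_contDiffOn hO hG hinv) (hi.clm_apply continuousOn_const) continuousOn_const
    (hi.clm_apply continuousOn_const))).clm_apply continuousOn_const

end CoordinateCurvature

/-! ### The metric in a chart, and continuity of the scalar curvature. -/

section ChartMetric

set_option maxSynthPendingDepth 3
set_option linter.unusedSectionVars false

variable {n : ℕ} {X : Type*} [MetricSpace X] [ChartedSpace (EuclideanSpace ℝ (Fin (n + 1))) X]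
  [IsManifold (𝓡 (n + 1)) ∞ X]

/-- The derivative of the preferred chart at `p`, as a map to the model space. -/
noncomputable def chartDeriv (p q : X) :
    TangentSpace (𝓡 (n + 1)) q →L[ℝ] EuclideanSpace ℝ (Fin (n + 1)) :=
  mfderiv (𝓡 (n + 1)) 𝓘(ℝ, EuclideanSpace ℝ (Fin (n + 1))) (extChartAt (𝓡 (n + 1)) p) q

/-- The derivative of the inverse of the preferred chart at `p`. -/
noncomputable def chartDerivSymm (p : X) (y : EuclideanSpace ℝ (Fin (n + 1))) :
    EuclideanSpace ℝ (Fin (n + 1)) →L[ℝ]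
      TangentSpace (𝓡 (n + 1)) ((extChartAt (𝓡 (n + 1)) p).symm y) :=
  mfderiv 𝓘(ℝ, EuclideanSpace ℝ (Fin (n + 1))) (𝓡 (n + 1)) (extChartAt (𝓡 (n + 1)) p).symm y

theorem chartDeriv_chartDerivSymm {p : X} {y : EuclideanSpace ℝ (Fin (n + 1))}
    (hy : y ∈ (extChartAt (𝓡 (n + 1)) p).target) (v : EuclideanSpace ℝ (Fin (n + 1))) :
    chartDeriv p ((extChartAt (𝓡 (n + 1)) p).symm y) (chartDerivSymm p y v) = v := by
  have h := mfderiv_extChartAt_comp_mfderivWithin_extChartAt_symm (I := 𝓡 (n + 1)) hy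
  rw [ModelWithCorners.range_eq_univ, mfderivWithin_univ] at h
  exact congrArg (fun L => L v) h

theorem chartDerivSymm_chartDeriv {p : X} {y : EuclideanSpace ℝ (Fin (n + 1))}
    (hy : y ∈ (extChartAt (𝓡 (n + 1)) p).target)
    (v : TangentSpace (𝓡 (n + 1)) ((extChartAt (𝓡 (n + 1)) p).symm y)) :
    chartDerivSymm p y (chartDeriv p ((extChartAt (𝓡 (n + 1)) p).symm y) v) = v := by
  have h := mfderivWithin_extChartAt_symm_comp_mfderiv_extChartAt (I := 𝓡 (n + 1)) hy
  rw [ModelWithCorners.range_eq_univ, mfderivWithin_univ] at h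
  exact congrArg (fun L => L v) h

theorem chartDeriv_surjective {p q : X} (hq : q ∈ (extChartAt (𝓡 (n + 1)) p).source) :
    Function.Surjective (chartDeriv (n := n) p q) := by
  obtain ⟨y, hy, rfl⟩ : ∃ y ∈ (extChartAt (𝓡 (n + 1)) p).target,
      (extChartAt (𝓡 (n + 1)) p).symm y = q :=
    ⟨_, (extChartAt (𝓡 (n + 1)) p).map_source hq, (extChartAt (𝓡 (n + 1)) p).left_inv hq⟩
  exact fun z => ⟨_, chartDeriv_chartDerivSymm hy z⟩

theorem isOpen_transition (p q : X) : IsOpen ((extChartAt (𝓡 (n + 1)) q).target ∩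
    (extChartAt (𝓡 (n + 1)) q).symm ⁻¹' (extChartAt (𝓡 (n + 1)) p).source) :=
  (continuousOn_extChartAt_symm q).isOpen_inter_preimage (isOpen_extChartAt_target q)
    (isOpen_extChartAt_source p)

theorem fderiv_transition (p q : X) {y : EuclideanSpace ℝ (Fin (n + 1))}
    (hy : y ∈ (extChartAt (𝓡 (n + 1)) q).target)
    (hy' : (extChartAt (𝓡 (n + 1)) q).symm y ∈ (extChartAt (𝓡 (n + 1)) p).source)
    (v : EuclideanSpace ℝ (Fin (n + 1))) :
    fderiv ℝ (extChartAt (𝓡 (n + 1)) p ∘ (extChartAt (𝓡 (n + 1)) q).symm) y v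
      = chartDeriv p ((extChartAt (𝓡 (n + 1)) q).symm y) (chartDerivSymm q y v) := by
  have hs := mdifferentiableWithinAt_extChartAt_symm (I := 𝓡 (n + 1)) hy
  rw [ModelWithCorners.range_eq_univ, mdifferentiableWithinAt_univ] at hs
  rw [extChartAt_source] at hy'
  have := mfderiv_comp y (mdifferentiableAt_extChartAt (I := 𝓡 (n + 1)) hy') hs
  rw [mfderiv_eq_fderiv] at this
  exact congrArg (fun L => L v) this

theorem fderiv_transition_chartDeriv (p q : X) {x : X}
    (hq : x ∈ (extChartAt (𝓡 (n + 1)) q).source) (hp : x ∈ (extChartAt (𝓡 (n + 1)) p).source)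
    (v : TangentSpace (𝓡 (n + 1)) x) :
    fderiv ℝ (extChartAt (𝓡 (n + 1)) p ∘ (extChartAt (𝓡 (n + 1)) q).symm)
      (extChartAt (𝓡 (n + 1)) q x) (chartDeriv q x v) = chartDeriv p x v := by
  obtain ⟨y, hy, rfl⟩ : ∃ y ∈ (extChartAt (𝓡 (n + 1)) q).target,
      (extChartAt (𝓡 (n + 1)) q).symm y = x :=
    ⟨_, (extChartAt (𝓡 (n + 1)) q).map_source hq, (extChartAt (𝓡 (n + 1)) q).left_inv hq⟩
  rw [(extChartAt (𝓡 (n + 1)) q).right_inv hy, fderiv_transition p q hy hp,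
    chartDerivSymm_chartDeriv hy]

variable [RiemannianBundle (fun x : X => TangentSpace (𝓡 (n + 1)) x)]

theorem chartMetric_apply (p : X) (y v w : EuclideanSpace ℝ (Fin (n + 1))) :
    chartMetric p y v w = inner ℝ (chartDerivSymm p y v) (chartDerivSymm p y w) := rfl

theorem chartMetric_symm (p : X) (y v w : EuclideanSpace ℝ (Fin (n + 1))) :
    chartMetric p y v w = chartMetric p y w v := by
  rw [chartMetric_apply, chartMetric_apply, real_inner_comm]

theorem chartMetric_chartDeriv {p q : X} (hq : q ∈ (extChartAt (𝓡 (n + 1)) p).source)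
    (v w : TangentSpace (𝓡 (n + 1)) q) :
    chartMetric p (extChartAt (𝓡 (n + 1)) p q) (chartDeriv p q v) (chartDeriv p q w)
      = inner ℝ v w := by
  obtain ⟨y, hy, rfl⟩ : ∃ y ∈ (extChartAt (𝓡 (n + 1)) p).target,
      (extChartAt (𝓡 (n + 1)) p).symm y = q :=
    ⟨_, (extChartAt (𝓡 (n + 1)) p).map_source hq, (extChartAt (𝓡 (n + 1)) p).left_inv hq⟩
  rw [(extChartAt (𝓡 (n + 1)) p).right_inv hy, chartMetric_apply, chartDerivSymm_chartDeriv hy,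
    chartDerivSymm_chartDeriv hy]

theorem chartMetric_isInvertible {p : X} {y : EuclideanSpace ℝ (Fin (n + 1))}
    (hy : y ∈ (extChartAt (𝓡 (n + 1)) p).target) : (chartMetric p y).IsInvertible := by
  have hinj : Function.Injective (chartMetric p y) := by
    rw [injective_iff_map_eq_zero]
    intro v hv
    have h1 : chartMetric p y v v = 0 := by rw [hv]; rfl
    rw [chartMetric_apply, inner_self_eq_zero] at h1
    rw [← chartDeriv_chartDerivSymm hy v, h1, map_zero]
  have hfin : Module.finrank ℝ (EuclideanSpace ℝ (Fin (n + 1)))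
      = Module.finrank ℝ (EuclideanSpace ℝ (Fin (n + 1)) →L[ℝ] ℝ) := by
    rw [← LinearMap.toContinuousLinearMap.finrank_eq]
    exact (Subspace.dual_finrank_eq).symm
  refine ⟨(LinearEquiv.ofInjectiveOfFinrankEq (chartMetric p y).toLinearMap hinj
    hfin).toContinuousLinearEquiv, ?_⟩
  ext v w
  rfl

/-- The coordinate fields of the chart correspond to constant vectors in the tangent trivialization
at `p`; they are therefore smooth sections, and the bundle metric is smooth on these. -/
theorem chartMetric_contDiffOn
    [IsContMDiffRiemannianBundle (𝓡 (n + 1)) ∞ (EuclideanSpace ℝ (Fin (n + 1)))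
      (fun x : X => TangentSpace (𝓡 (n + 1)) x)] (p : X) :
    ContDiffOn ℝ ∞ (chartMetric p) (extChartAt (𝓡 (n + 1)) p).target := by
  refine contDiffOn_clm_apply.2 fun v => contDiffOn_clm_apply.2 fun w => ?_
  rw [← contMDiffOn_iff_contDiffOn]
  have hs := contMDiffOn_extChartAt_symm (I := 𝓡 (n + 1)) (n := ∞) p
  let e := trivializationAt (EuclideanSpace ℝ (Fin (n + 1)))
    (fun x : X => TangentSpace (𝓡 (n + 1)) x) p
  have hsec : ∀ v : EuclideanSpace ℝ (Fin (n + 1)),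
      ContMDiffOn 𝓘(ℝ, EuclideanSpace ℝ (Fin (n + 1))) ((𝓡 (n + 1)).tangent) ∞
      (fun y => (⟨(extChartAt (𝓡 (n + 1)) p).symm y, chartDerivSymm p y v⟩ :
        TotalSpace (EuclideanSpace ℝ (Fin (n + 1)))
          (fun x : X => TangentSpace (𝓡 (n + 1)) x))) (extChartAt (𝓡 (n + 1)) p).target := by
    intro v
    have h1 : ContMDiffOn (𝓡 (n + 1)) ((𝓡 (n + 1)).tangent) ∞
        (fun q : X => (⟨q, e.symmL ℝ q v⟩ : TotalSpace (EuclideanSpace ℝ (Fin (n + 1)))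
          (fun x : X => TangentSpace (𝓡 (n + 1)) x))) e.baseSet := by
      rw [e.contMDiffOn_section_baseSet_iff]
      refine (contMDiffOn_const (c := v)).congr fun q hq => ?_
      have := e.continuousLinearMapAt_symmL (R := ℝ) hq v
      rwa [Trivialization.continuousLinearMapAt_apply,
        Trivialization.coe_linearMapAt_of_mem _ hq] at this
    have hmaps : Set.MapsTo (extChartAt (𝓡 (n + 1)) p).symm (extChartAt (𝓡 (n + 1)) p).target
        e.baseSet := by
      intro y hy
      rw [TangentBundle.trivializationAt_baseSet, ← extChartAt_source (𝓡 (n + 1))]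
      exact (extChartAt (𝓡 (n + 1)) p).map_target hy
    refine (h1.comp hs hmaps).congr fun y hy => ?_
    have h2 := hmaps hy
    rw [TangentBundle.trivializationAt_baseSet] at h2
    have h3 := congrArg (fun L => L v) (TangentBundle.symmL_trivializationAt
      (I := 𝓡 (n + 1)) (𝕜 := ℝ) h2)
    rw [(extChartAt (𝓡 (n + 1)) p).right_inv hy, ModelWithCorners.range_eq_univ,
      mfderivWithin_univ] at h3
    exact congrArg (TotalSpace.mk _) h3.symm
  exact ContMDiffOn.inner_bundle (hsec v) (hsec w)

variable [IsContMDiffRiemannianBundle (𝓡 (n + 1)) ∞ (EuclideanSpace ℝ (Fin (n + 1)))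
      (fun x : X => TangentSpace (𝓡 (n + 1)) x)]

theorem isMetricPullback_transition (p q : X) :
    IsMetricPullback (chartMetric p) (chartMetric q)
      (extChartAt (𝓡 (n + 1)) p ∘ (extChartAt (𝓡 (n + 1)) q).symm)
      (extChartAt (𝓡 (n + 1)) p).target
      ((extChartAt (𝓡 (n + 1)) q).target ∩
        (extChartAt (𝓡 (n + 1)) q).symm ⁻¹' (extChartAt (𝓡 (n + 1)) p).source) where
  isOpen := isOpen_extChartAt_target p
  isOpen' := isOpen_transition p q
  mapsTo y hy := (extChartAt (𝓡 (n + 1)) p).map_source hy.2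
  smooth := by
    rw [← contMDiffOn_iff_contDiffOn]
    have h1 := contMDiffOn_extChartAt_symm (I := 𝓡 (n + 1)) (n := ∞) q
    have h2 := contMDiffOn_extChartAt (I := 𝓡 (n + 1)) (n := ∞) (x := p)
    rw [← extChartAt_source (𝓡 (n + 1))] at h2
    exact h2.comp (h1.mono Set.inter_subset_left) fun y hy => hy.2
  metric_smooth := chartMetric_contDiffOn p
  metric_smooth' := (chartMetric_contDiffOn q).mono Set.inter_subset_left
  metric_symm y _ v w := chartMetric_symm p y v w
  invertible y hy := chartMetric_isInvertible hy
  invertible' y hy := chartMetric_isInvertible hy.1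
  surjective y hy z := by
    obtain ⟨v, hv⟩ := chartDeriv_surjective hy.2 z
    exact ⟨chartDeriv q ((extChartAt (𝓡 (n + 1)) q).symm y) v, by
      rw [fderiv_transition p q hy.1 hy.2, chartDerivSymm_chartDeriv hy.1, hv]⟩
  pullback y hy v w := by
    rw [fderiv_transition p q hy.1 hy.2, fderiv_transition p q hy.1 hy.2, Function.comp_apply,
      chartMetric_chartDeriv hy.2, chartMetric_apply]

/-- The tensor at `q` is defined in the chart of `q`. The transition map to the chart of `p` is a
metric pullback, so the same number is computed in a chart that stays fixed as `q` varies. -/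
theorem riemannTensor_eq (p : X) {q : X} (hq : q ∈ (extChartAt (𝓡 (n + 1)) p).source)
    (u v w z : TangentSpace (𝓡 (n + 1)) q) :
    riemannTensor q u v w z = chartMetric p (extChartAt (𝓡 (n + 1)) p q)
      (curvatureL (christoffelL (chartMetric p)) (extChartAt (𝓡 (n + 1)) p q)
        (chartDeriv p q u) (chartDeriv p q v) (chartDeriv p q w)) (chartDeriv p q z) := by
  have H := isMetricPullback_transition (n := n) p q
  have hqq := mem_extChartAt_source (I := 𝓡 (n + 1)) q
  set y := extChartAt (𝓡 (n + 1)) q q with hy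
  have hqy : (extChartAt (𝓡 (n + 1)) q).symm y = q := (extChartAt (𝓡 (n + 1)) q).left_inv hqq
  have hyt : y ∈ (extChartAt (𝓡 (n + 1)) q).target := (extChartAt (𝓡 (n + 1)) q).map_source hqq
  have hyO : y ∈ (extChartAt (𝓡 (n + 1)) q).target ∩
        (extChartAt (𝓡 (n + 1)) q).symm ⁻¹' (extChartAt (𝓡 (n + 1)) p).source :=
    ⟨hyt, by rw [Set.mem_preimage, hqy]; exact hq⟩
  have hd : ∀ v : TangentSpace (𝓡 (n + 1)) q,
      fderiv ℝ (extChartAt (𝓡 (n + 1)) p ∘ (extChartAt (𝓡 (n + 1)) q).symm) y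
        (chartDeriv q q v) = chartDeriv p q v :=
    fderiv_transition_chartDeriv p q hqq hq
  have hdiff : DifferentiableAt ℝ (christoffelL (chartMetric q)) y :=
    ((christoffelL_contDiffOn (isOpen_extChartAt_target q) (chartMetric_contDiffOn q)
      fun y hy => chartMetric_isInvertible hy).contDiffAt
      ((isOpen_extChartAt_target q).mem_nhds hyt)).differentiableAt (by simp)
  change chartMetric q y (coordCurvature (chartMetric q) y (chartDeriv q q u) (chartDeriv q q v)
    (chartDeriv q q w)) (chartDeriv q q z) = _
  rw [coordCurvature_eq_curvatureL hdiff, H.pullback y hyO, H.curvature_transform hyO]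
  simp only [hd, Function.comp_apply, hqy]

theorem scalarCurvature_eq (p : X) {q : X} (hq : q ∈ (extChartAt (𝓡 (n + 1)) p).source) :
    scalarCurvature n q = coordScalar (EuclideanSpace.basisFun (Fin (n + 1)) ℝ).toBasis
      (fun a => EuclideanSpace.proj a) (chartMetric p) (extChartAt (𝓡 (n + 1)) p q) := by
  have hyt : extChartAt (𝓡 (n + 1)) p q ∈ (extChartAt (𝓡 (n + 1)) p).target :=
    (extChartAt (𝓡 (n + 1)) p).map_source hq
  rw [← coordScalar_eq (κ := Fin (Module.finrank ℝ (TangentSpace (𝓡 (n + 1)) q)))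
    (chartMetric_isInvertible hyt)
    (e := fun i => chartDeriv p q (stdOrthonormalBasis ℝ (TangentSpace (𝓡 (n + 1)) q) i))]
  · simp only [scalarCurvature, riemannTensor_eq p hq]
  · intro z
    obtain ⟨v, rfl⟩ := chartDeriv_surjective hq z
    simp only [chartMetric_chartDeriv hq]
    conv_lhs => rw [← (stdOrthonormalBasis ℝ (TangentSpace (𝓡 (n + 1)) q)).sum_repr' v]
    rw [map_sum]
    simp only [map_smul]
  · intro a z
    simp

theorem continuous_scalarCurvature : Continuous (fun q : X => scalarCurvature n q) := by
  rw [continuous_iff_continuousAt]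
  intro p
  have h := coordScalar_continuousOn (EuclideanSpace.basisFun (Fin (n + 1)) ℝ).toBasis
      (fun a => EuclideanSpace.proj a) (isOpen_extChartAt_target p) (chartMetric_contDiffOn p)
      fun y hy => chartMetric_isInvertible hy
  have h1 : ContinuousAt (fun q => coordScalar (EuclideanSpace.basisFun (Fin (n + 1)) ℝ).toBasis
      (fun a => EuclideanSpace.proj a) (chartMetric p) (extChartAt (𝓡 (n + 1)) p q)) p :=
    ContinuousAt.comp (g := coordScalar (EuclideanSpace.basisFun (Fin (n + 1)) ℝ).toBasis
      (fun a => EuclideanSpace.proj a) (chartMetric p)) (h.continuousAt ((isOpen_extChartAt_target p).mem_nhds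
      (mem_extChartAt_target p))) (continuousAt_extChartAt p)
  refine h1.congr ?_
  filter_upwards [extChartAt_source_mem_nhds (I := 𝓡 (n + 1)) p] with q hq
  rw [scalarCurvature_eq p hq]

end ChartMetric

/-! ### Local control of gradients, distances and Hausdorff measures by charts. -/

section LocalGeometry

set_option maxSynthPendingDepth 3
set_option linter.unusedSectionVars false

variable {n : ℕ} {X : Type*} [MetricSpace X] [ChartedSpace (EuclideanSpace ℝ (Fin (n + 1))) X]
  [IsManifold (𝓡 (n + 1)) ∞ X]

theorem mvfderiv_chart {f : X → ℝ} (p : X) {q : X}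
    (hq : q ∈ (extChartAt (𝓡 (n + 1)) p).source) (hf : MDifferentiableAt (𝓡 (n + 1)) 𝓘(ℝ, ℝ) f q)
    (v : TangentSpace (𝓡 (n + 1)) q) :
    mvfderiv (𝓡 (n + 1)) f q v = fderiv ℝ (f ∘ (extChartAt (𝓡 (n + 1)) p).symm)
      (extChartAt (𝓡 (n + 1)) p q) (chartDeriv p q v) := by
  obtain ⟨y, hy, rfl⟩ : ∃ y ∈ (extChartAt (𝓡 (n + 1)) p).target,
      (extChartAt (𝓡 (n + 1)) p).symm y = q :=
    ⟨_, (extChartAt (𝓡 (n + 1)) p).map_source hq, (extChartAt (𝓡 (n + 1)) p).left_inv hq⟩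
  have hs := mdifferentiableWithinAt_extChartAt_symm (I := 𝓡 (n + 1)) hy
  rw [ModelWithCorners.range_eq_univ, mdifferentiableWithinAt_univ] at hs
  have := mfderiv_comp y hf hs
  rw [mfderiv_eq_fderiv] at this
  have h2 := congrArg (fun L => L (chartDeriv p _ v)) this
  rw [(extChartAt (𝓡 (n + 1)) p).right_inv hy]
  refine Eq.trans ?_ h2.symm
  have h3 := chartDerivSymm_chartDeriv hy v
  change _ = mfderiv (𝓡 (n + 1)) 𝓘(ℝ, ℝ) f _ (chartDerivSymm p y _)
  rw [h3]
  rfl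

theorem contDiffOn_comp_chart_symm {f : X → ℝ} (hf : ContMDiff (𝓡 (n + 1)) 𝓘(ℝ, ℝ) ∞ f) (p : X) :
    ContDiffOn ℝ ∞ (f ∘ (extChartAt (𝓡 (n + 1)) p).symm) (extChartAt (𝓡 (n + 1)) p).target := by
  rw [← contMDiffOn_iff_contDiffOn]
  exact hf.comp_contMDiffOn (contMDiffOn_extChartAt_symm p)

variable [RiemannianBundle (fun x : X => TangentSpace (𝓡 (n + 1)) x)]
  [IsContMDiffRiemannianBundle (𝓡 (n + 1)) ∞ (EuclideanSpace ℝ (Fin (n + 1)))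
      (fun x : X => TangentSpace (𝓡 (n + 1)) x)]

/-- Lengths are compared through `L` with the Riemannian norm of the tangent space at `p`. The
distortion is then the universal constant 2, whatever `p` is, which is what makes the later gradient
bounds uniform. -/
theorem exists_ball_normalized_chart (p : X) :
    ∃ L : EuclideanSpace ℝ (Fin (n + 1)) ≃L[ℝ] TangentSpace (𝓡 (n + 1)) p, ∃ ρ > 0,
      Metric.ball (extChartAt (𝓡 (n + 1)) p p) ρ ⊆ (extChartAt (𝓡 (n + 1)) p).target ∧
      ∀ y ∈ Metric.ball (extChartAt (𝓡 (n + 1)) p p) ρ,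
        (∀ v, ‖chartDerivSymm p y v‖ ≤ 2 * ‖L v‖) ∧
        ∀ v, ‖L (chartDeriv p ((extChartAt (𝓡 (n + 1)) p).symm y) v)‖ ≤ 2 * ‖v‖ := by
  have : IsContinuousRiemannianBundle (EuclideanSpace ℝ (Fin (n + 1)))
      (fun x : X => TangentSpace (𝓡 (n + 1)) x) := by
    obtain ⟨g, hg, h⟩ := IsContMDiffRiemannianBundle.exists_contMDiff (IB := 𝓡 (n + 1)) (n := ∞)
      (F := EuclideanSpace ℝ (Fin (n + 1))) (E := fun x : X => TangentSpace (𝓡 (n + 1)) x)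
    exact ⟨g, hg.continuous, h⟩
  let e := trivializationAt (EuclideanSpace ℝ (Fin (n + 1)))
    (fun x : X => TangentSpace (𝓡 (n + 1)) x) p
  have hp : p ∈ e.baseSet := FiberBundle.mem_baseSet_trivializationAt' p
  have h1 := eventually_norm_symmL_trivializationAt_self_comp_lt
    (EuclideanSpace ℝ (Fin (n + 1))) (fun x : X => TangentSpace (𝓡 (n + 1)) x) p one_lt_two
  have h2 := eventually_norm_symmL_trivializationAt_comp_self_lt
    (EuclideanSpace ℝ (Fin (n + 1))) (fun x : X => TangentSpace (𝓡 (n + 1)) x) p one_lt_two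
  have h3 : ∀ᶠ q in 𝓝 p, q ∈ (extChartAt (𝓡 (n + 1)) p).source :=
    extChartAt_source_mem_nhds (I := 𝓡 (n + 1)) p
  have hc : Filter.Tendsto (extChartAt (𝓡 (n + 1)) p).symm
      (𝓝 (extChartAt (𝓡 (n + 1)) p p)) (𝓝 p) := by
    have := continuousAt_extChartAt_symm (I := 𝓡 (n + 1)) p
    rwa [ContinuousAt, extChartAt_to_inv] at this
  have h4 := (hc.eventually (h1.and (h2.and h3))).and
    (extChartAt_target_mem_nhds (I := 𝓡 (n + 1)) p)
  obtain ⟨ρ, hρ, hball⟩ := Metric.eventually_nhds_iff_ball.1 h4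
  have hL : ∀ v, (e.continuousLinearEquivAt ℝ p hp).symm v = e.symmL ℝ p v :=
    fun v => congrFun (e.symm_continuousLinearEquivAt_eq hp) v
  refine ⟨(e.continuousLinearEquivAt ℝ p hp).symm, ρ, hρ, fun y hy => (hball y hy).2, ?_⟩
  intro y hy
  obtain ⟨⟨g1, g2, g3⟩, g4⟩ := hball y hy
  have g3' := g3
  rw [extChartAt_source] at g3'
  constructor
  · intro v
    have k := TangentBundle.symmL_trivializationAt (I := 𝓡 (n + 1)) (𝕜 := ℝ) g3'
    rw [(extChartAt (𝓡 (n + 1)) p).right_inv g4, ModelWithCorners.range_eq_univ,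
      mfderivWithin_univ] at k
    have := ContinuousLinearMap.le_of_opNorm_le _ g2.le
      ((e.continuousLinearEquivAt ℝ p hp).symm v)
    refine le_trans (le_of_eq ?_) this
    have k2 : e.continuousLinearMapAt ℝ p ((e.continuousLinearEquivAt ℝ p hp).symm v) = v := by
      rw [hL]; exact e.continuousLinearMapAt_symmL (R := ℝ) hp v
    have k3 := congrArg (fun M => M v) k
    rw [ContinuousLinearMap.comp_apply, k2]
    exact congrArg norm k3.symm
  · intro v
    have k := TangentBundle.continuousLinearMapAt_trivializationAt (I := 𝓡 (n + 1)) (𝕜 := ℝ) g3'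
    have := ContinuousLinearMap.le_of_opNorm_le _ g1.le v
    refine le_trans (le_of_eq ?_) this
    have k3 := congrArg (fun M => M v) k
    rw [ContinuousLinearMap.comp_apply]
    rw [hL]
    exact congrArg (fun w => ‖e.symmL ℝ p w‖) k3.symm

/-- The dual norm is a supremum of |df(w)|/|w|, and for a coordinate-constant `w` this quotient is
continuous. It supplies measurability of |∇u|²/u. -/
theorem lowerSemicontinuous_norm_mvfderiv {f : X → ℝ}
    (hf : ContMDiff (𝓡 (n + 1)) 𝓘(ℝ, ℝ) ∞ f) :
    LowerSemicontinuous fun q => ‖mvfderiv (𝓡 (n + 1)) f q‖ := by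
  intro p c hc
  rcases lt_or_ge c 0 with hc0 | hc0
  · exact Filter.Eventually.of_forall fun q => hc0.trans_le (norm_nonneg _)
  obtain ⟨v, hv⟩ : ∃ v, c * ‖v‖ < ‖mvfderiv (𝓡 (n + 1)) f p v‖ := by
    by_contra! h
    exact absurd (ContinuousLinearMap.opNorm_le_bound _ hc0 h) (not_le.2 hc)
  set w := chartDeriv p p v with hw
  have hp := mem_extChartAt_source (I := 𝓡 (n + 1)) p
  have hfd : ∀ q, MDifferentiableAt (𝓡 (n + 1)) 𝓘(ℝ, ℝ) f q :=
    fun q => hf.contMDiffAt.mdifferentiableAt (by simp)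
  have hT := (isOpen_extChartAt_target (I := 𝓡 (n + 1)) p).mem_nhds (mem_extChartAt_target p)
  have c1 : ContinuousAt (fun q => c * √(chartMetric p (extChartAt (𝓡 (n + 1)) p q) w w)) p := by
    have h1 : ContinuousAt (chartMetric p) (extChartAt (𝓡 (n + 1)) p p) :=
      (chartMetric_contDiffOn p).continuousOn.continuousAt hT
    have h2 := h1.comp (continuousAt_extChartAt (I := 𝓡 (n + 1)) p)
    exact continuousAt_const.mul ((h2.clm_apply continuousAt_const).clm_apply
      continuousAt_const).sqrt
  have c2 : ContinuousAt (fun q => ‖fderiv ℝ (f ∘ (extChartAt (𝓡 (n + 1)) p).symm)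
      (extChartAt (𝓡 (n + 1)) p q) w‖) p := by
    have h1 := ((contDiffOn_comp_chart_symm hf p).continuousOn_fderiv_of_isOpen
      (isOpen_extChartAt_target p) (by simp)).continuousAt hT
    have h2 := ContinuousAt.comp h1 (continuousAt_extChartAt (I := 𝓡 (n + 1)) p)
    exact (h2.clm_apply continuousAt_const).norm
  have hlt : c * √(chartMetric p (extChartAt (𝓡 (n + 1)) p p) w w)
      < ‖fderiv ℝ (f ∘ (extChartAt (𝓡 (n + 1)) p).symm) (extChartAt (𝓡 (n + 1)) p p) w‖ := by
    rw [hw, chartMetric_chartDeriv hp, ← mvfderiv_chart p hp (hfd p), real_inner_self_eq_norm_sq,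
      Real.sqrt_sq (norm_nonneg _)]
    exact hv
  filter_upwards [c1.eventually_lt c2 hlt, extChartAt_source_mem_nhds (I := 𝓡 (n + 1)) p]
    with q hq hqs
  obtain ⟨v', hv'⟩ := chartDeriv_surjective hqs w
  rw [← hv', chartMetric_chartDeriv hqs, ← mvfderiv_chart p hqs (hfd q),
    real_inner_self_eq_norm_sq, Real.sqrt_sq (norm_nonneg _)] at hq
  by_contra! h
  exact absurd (ContinuousLinearMap.le_of_opNorm_le _ h v') (not_le.2 hq)

theorem eventually_norm_mvfderiv_le {f : X → ℝ}
    (hf : ContMDiff (𝓡 (n + 1)) 𝓘(ℝ, ℝ) ∞ f) (p : X) :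
    ∃ C : ℝ, ∀ᶠ q in 𝓝 p, ‖mvfderiv (𝓡 (n + 1)) f q‖ ≤ C := by
  obtain ⟨L, ρ, hρ, hsub, hL⟩ := exists_ball_normalized_chart (n := n) p
  have hT := (isOpen_extChartAt_target (I := 𝓡 (n + 1)) p).mem_nhds (mem_extChartAt_target p)
  have h1 := ((contDiffOn_comp_chart_symm hf p).continuousOn_fderiv_of_isOpen
      (isOpen_extChartAt_target p) (by simp)).continuousAt hT
  have h2 := (ContinuousAt.comp h1 (continuousAt_extChartAt (I := 𝓡 (n + 1)) p)).norm
  have h3 := h2.eventually_lt_const (lt_add_one _)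
  set M := ‖(fderiv ℝ (f ∘ (extChartAt (𝓡 (n + 1)) p).symm) ∘ extChartAt (𝓡 (n + 1)) p) p‖ + 1
  have hM : 0 ≤ M := by positivity
  refine ⟨M * (‖L.symm.toContinuousLinearMap‖ * 2), ?_⟩
  filter_upwards [h3, extChartAt_source_mem_nhds (I := 𝓡 (n + 1)) p,
    (continuousAt_extChartAt (I := 𝓡 (n + 1)) p).preimage_mem_nhds (Metric.ball_mem_nhds _ hρ)]
    with q hq hqs hqb
  refine ContinuousLinearMap.opNorm_le_bound _ (by positivity) fun v => ?_
  rw [mvfderiv_chart p hqs (hf.contMDiffAt.mdifferentiableAt (by simp))]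
  have h5 := (hL _ hqb).2
  rw [(extChartAt (𝓡 (n + 1)) p).left_inv hqs] at h5
  have h6 : ‖chartDeriv p q v‖
      ≤ ‖L.symm.toContinuousLinearMap‖ * ‖L (chartDeriv p q v)‖ := by
    have := L.symm.toContinuousLinearMap.le_opNorm (L (chartDeriv p q v))
    simpa using this
  calc _ ≤ M * ‖chartDeriv p q v‖ := ContinuousLinearMap.le_of_opNorm_le _ hq.le _
    _ ≤ M * (‖L.symm.toContinuousLinearMap‖ * (2 * ‖v‖)) := by
        gcongr
        exact h6.trans (by gcongr; exact h5 v)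
    _ = _ := by ring

variable [IsRiemannianManifold (𝓡 (n + 1)) X]

/-- The straight segment in the chart is a competitor for the Riemannian distance; convexity of `B`
keeps it where the derivative bound holds. -/
theorem dist_chart_symm_le {p : X} {F : Type*} [NormedAddCommGroup F] [NormedSpace ℝ F]
    {L : EuclideanSpace ℝ (Fin (n + 1)) →L[ℝ] F} {C : ℝ} (hC : 0 ≤ C)
    {B : Set (EuclideanSpace ℝ (Fin (n + 1)))} (hB : Convex ℝ B)
    (hsub : B ⊆ (extChartAt (𝓡 (n + 1)) p).target)
    (hL : ∀ y ∈ B, ∀ v, ‖chartDerivSymm p y v‖ ≤ C * ‖L v‖)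
    {y y' : EuclideanSpace ℝ (Fin (n + 1))} (hy : y ∈ B) (hy' : y' ∈ B) :
    dist ((extChartAt (𝓡 (n + 1)) p).symm y) ((extChartAt (𝓡 (n + 1)) p).symm y')
      ≤ C * ‖L (y' - y)‖ := by
  let η := ContinuousAffineMap.lineMap (R := ℝ) y y'
  set γ := (extChartAt (𝓡 (n + 1)) p).symm ∘ η with hγ
  have hη : Set.MapsTo η (Set.Icc 0 1) B := by
    intro t ht
    apply hB.segment_subset hy hy'
    rw [segment_eq_image_lineMap]
    exact ⟨t, ht, rfl⟩
  have η_smooth : ContMDiff 𝓘(ℝ, ℝ) 𝓘(ℝ, EuclideanSpace ℝ (Fin (n + 1))) 1 η := by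
    rw [contMDiff_iff_contDiff]
    exact ContinuousAffineMap.contDiff _
  have h1 : riemannianEDist (𝓡 (n + 1)) ((extChartAt (𝓡 (n + 1)) p).symm y)
      ((extChartAt (𝓡 (n + 1)) p).symm y') ≤ pathELength (𝓡 (n + 1)) γ 0 1 := by
    apply riemannianEDist_le_pathELength _ _ _ zero_le_one
    · exact (contMDiffOn_extChartAt_symm p).comp η_smooth.contMDiffOn fun t ht => hsub (hη ht)
    · simp [γ, η, ContinuousAffineMap.coe_lineMap_eq]
    · simp [γ, η, ContinuousAffineMap.coe_lineMap_eq]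
  have h2 : pathELength (𝓡 (n + 1)) γ 0 1 ≤ ENNReal.ofReal (C * ‖L (y' - y)‖) := by
    rw [pathELength_eq_lintegral_mfderiv_Icc]
    refine (setLIntegral_mono' (g := fun _ => ENNReal.ofReal (C * ‖L (y' - y)‖))
      measurableSet_Icc fun t ht => ?_).trans ?_
    · have ht' := hsub (hη ht)
      have hs := mdifferentiableWithinAt_extChartAt_symm (I := 𝓡 (n + 1)) ht'
      rw [ModelWithCorners.range_eq_univ, mdifferentiableWithinAt_univ] at hs
      have h3 := mfderiv_comp t hs (η_smooth.mdifferentiableAt (by simp))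
      have h4 : mfderiv 𝓘(ℝ, ℝ) (𝓡 (n + 1)) γ t 1 = chartDerivSymm p (η t) (y' - y) := by
        rw [hγ, h3]
        have h5 : mfderiv 𝓘(ℝ, ℝ) 𝓘(ℝ, EuclideanSpace ℝ (Fin (n + 1))) η t 1 = y' - y := by
          rw [mfderiv_eq_fderiv]
          have : fderiv ℝ η t 1 = y' - y := by simp [η]
          exact this
        exact congrArg (chartDerivSymm p (η t)) h5
      rw [h4, ← ofReal_norm]
      exact ENNReal.ofReal_le_ofReal (hL _ (hη ht) _)
    · simp
  have h3 := h1.trans h2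
  rw [← IsRiemannianManifold.out (I := 𝓡 (n + 1)), edist_dist] at h3
  exact (ENNReal.ofReal_le_ofReal_iff (by positivity)).1 h3

theorem exists_lipschitzOnWith_chart_symm (p : X) :
    ∃ K : NNReal, ∃ ρ > 0, Metric.ball (extChartAt (𝓡 (n + 1)) p p) ρ ⊆
        (extChartAt (𝓡 (n + 1)) p).target ∧
      LipschitzOnWith K (extChartAt (𝓡 (n + 1)) p).symm
        (Metric.ball (extChartAt (𝓡 (n + 1)) p p) ρ) := by
  obtain ⟨L, ρ, hρ, hsub, hL⟩ := exists_ball_normalized_chart (n := n) p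
  refine ⟨2 * ‖L.toContinuousLinearMap‖₊, ρ, hρ, hsub, LipschitzOnWith.of_dist_le_mul ?_⟩
  intro y hy y' hy'
  refine (dist_chart_symm_le (L := L.toContinuousLinearMap) zero_le_two (convex_ball _ _) hsub
    (fun y hy => (hL y hy).1) hy hy').trans ?_
  rw [dist_comm, dist_eq_norm, NNReal.coe_mul, mul_assoc]
  push_cast
  gcongr
  exact L.toContinuousLinearMap.le_opNorm (y' - y)

theorem chart_symm_image_mem_nhds (p : X) {s : Set (EuclideanSpace ℝ (Fin (n + 1)))}
    (hs : s ∈ 𝓝 (extChartAt (𝓡 (n + 1)) p p)) :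
    (extChartAt (𝓡 (n + 1)) p).symm '' s ∈ 𝓝 p := by
  filter_upwards [(continuousAt_extChartAt (I := 𝓡 (n + 1)) p).preimage_mem_nhds hs,
    extChartAt_source_mem_nhds (I := 𝓡 (n + 1)) p] with q hq hqs
  exact ⟨_, hq, (extChartAt (𝓡 (n + 1)) p).left_inv hqs⟩

variable [MeasurableSpace X] [BorelSpace X]

theorem euclideanHausdorffMeasure_image_lt_top {Y Z : Type*} [EMetricSpace Y] [MeasurableSpace Y]
    [BorelSpace Y] [EMetricSpace Z] [MeasurableSpace Z] [BorelSpace Z] {d : ℕ} {K : NNReal}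
    {f : Y → Z} {s : Set Y} (hf : LipschitzOnWith K f s) (hs : (μHE[d] : Measure Y) s < ⊤) :
    (μHE[d] : Measure Z) (f '' s) < ⊤ := by
  have hc : (μHE[d] : Measure Z) (f '' s) ≤ (K : ENNReal) ^ (d : ℝ) * (μHE[d] : Measure Y) s := by
    simp only [Measure.euclideanHausdorffMeasure_def, Measure.smul_apply, ENNReal.smul_def,
      smul_eq_mul]
    rw [mul_left_comm]
    gcongr
    exact hf.hausdorffMeasure_image_le (Nat.cast_nonneg d)
  exact hc.trans_lt (ENNReal.mul_lt_top (by simp) hs)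

instance isLocallyFiniteMeasure_riemannianVolume :
    IsLocallyFiniteMeasure (riemannianVolume n X) := by
  refine ⟨fun p => ?_⟩
  obtain ⟨K, ρ, hρ, hsub, hK⟩ := exists_lipschitzOnWith_chart_symm (n := n) p
  refine ⟨_, chart_symm_image_mem_nhds p (Metric.ball_mem_nhds _ hρ),
    euclideanHausdorffMeasure_image_lt_top hK ?_⟩
  rw [EuclideanSpace.euclideanHausdorffMeasure_eq_volume]
  exact measure_ball_lt_top

/-- For two zeros y, z of f near y₀, strict differentiability makes ℓ(y - z) small against |y - z|.
Projection to ker ℓ is thus injective on the zero set with 2-Lipschitz inverse, and the zero set is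
a Lipschitz image of a bounded subset of a `d`-dimensional space. -/
theorem exists_nhds_measure_zeroSet_lt_top {E : Type*} [NormedAddCommGroup E]
    [InnerProductSpace ℝ E] [FiniteDimensional ℝ E] [MeasurableSpace E] [BorelSpace E] {d : ℕ}
    (hd : Module.finrank ℝ E = d + 1) {f : E → ℝ} {ℓ : E →L[ℝ] ℝ} {y₀ : E}
    (hf : HasStrictFDerivAt f ℓ y₀) (hℓ : ℓ ≠ 0) :
    ∃ V ∈ 𝓝 y₀, (μHE[d] : Measure E) {y ∈ V | f y = 0} < ⊤ := by
  obtain ⟨w₀, hw₀⟩ : ∃ w, ℓ w ≠ 0 := by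
    by_contra! h
    exact hℓ (ContinuousLinearMap.ext h)
  obtain ⟨w, hw⟩ : ∃ w, ℓ w = 1 := ⟨(ℓ w₀)⁻¹ • w₀, by simp [hw₀]⟩
  have hfin : Module.finrank ℝ (LinearMap.ker ℓ.toLinearMap) = d := by
    have := Module.Dual.finrank_ker_add_one_of_ne_zero (f := ℓ.toLinearMap)
      (fun h => hℓ (by ext v; exact congrArg (fun L => L v) h))
    omega
  let P : E →L[ℝ] LinearMap.ker ℓ.toLinearMap :=
    (ContinuousLinearMap.id ℝ E - ℓ.smulRight w).codRestrict _ (fun v => by simp [hw])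
  have hproj : ∀ v, (P v : E) = v - ℓ v • w := fun v => by simp [P]
  -- With this bound the component ℓ(y - z) w has at most half the length of y - z and can be
  -- absorbed.
  obtain ⟨ε, hε, hεw⟩ : ∃ ε : ℝ, 0 < ε ∧ ε * ‖w‖ ≤ 1 / 2 := by
    refine ⟨1 / (2 * (‖w‖ + 1)), by positivity, ?_⟩
    rw [div_mul_eq_mul_div, div_le_iff₀ (by positivity)]
    nlinarith [norm_nonneg w]
  have h1 := (hf.isLittleO.def hε)
  rw [nhds_prod_eq, Filter.eventually_prod_self_iff
    (r := fun x z => ‖f x - f z - ℓ (x - z)‖ ≤ ε * ‖x - z‖)] at h1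
  obtain ⟨t, ht, htt⟩ := h1
  refine ⟨t ∩ Metric.ball y₀ 1, Filter.inter_mem ht (Metric.ball_mem_nhds _ one_pos), ?_⟩
  set S := {y ∈ t ∩ Metric.ball y₀ 1 | f y = 0} with hS
  have key : ∀ y ∈ S, ∀ z ∈ S, ‖y - z‖ ≤ 2 * ‖P y - P z‖ := by
    intro y hy z hz
    have h2 := htt y hy.1.1 z hz.1.1
    simp only [hy.2, hz.2, sub_self, zero_sub, norm_neg] at h2
    have h3 : y - z = (P (y - z) : E) + ℓ (y - z) • w := by rw [hproj]; abel
    have h4 : ‖y - z‖ ≤ ‖P (y - z)‖ + ‖ℓ (y - z)‖ * ‖w‖ := by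
      calc ‖y - z‖ = ‖(P (y - z) : E) + ℓ (y - z) • w‖ := by rw [← h3]
        _ ≤ _ := (norm_add_le _ _).trans (by rw [norm_smul, Submodule.coe_norm])
    rw [← map_sub]
    nlinarith [norm_nonneg w, norm_nonneg (y - z),
      mul_le_mul_of_nonneg_right h2 (norm_nonneg w),
      mul_le_mul_of_nonneg_right hεw (norm_nonneg (y - z))]
  have hinj : Set.InjOn P S := by
    intro y hy z hz hyz
    have := key y hy z hz
    rw [hyz, sub_self, norm_zero, mul_zero] at this
    exact sub_eq_zero.1 (norm_le_zero_iff.1 this)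
  have hlip : LipschitzOnWith 2 (Function.invFunOn P S) (P '' S) := by
    refine LipschitzOnWith.of_dist_le_mul ?_
    rintro _ ⟨y, hy, rfl⟩ _ ⟨z, hz, rfl⟩
    rw [hinj.leftInvOn_invFunOn hy, hinj.leftInvOn_invFunOn hz, dist_eq_norm, dist_eq_norm]
    exact key y hy z hz
  have himg : Function.invFunOn P S '' (P '' S) = S :=
    hinj.leftInvOn_invFunOn.image_image
  rw [← himg]
  refine euclideanHausdorffMeasure_image_lt_top hlip ?_
  have hbdd : Bornology.IsBounded (P '' S) :=
    (Metric.isBounded_ball.subset (fun y hy => hy.1.2 : S ⊆ Metric.ball y₀ 1)).image P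
  rw [← hfin, InnerProductSpace.euclideanHausdorffMeasure_eq_volume]
  exact hbdd.measure_lt_top

theorem eq_zero_of_mem_frontier {Ω U : Set X} (hΩ : IsOpen Ω) (hU : IsOpen U) {ρ : X → ℝ}
    (hρ : ContinuousOn ρ U) (h : Ω ∩ U = {x ∈ U | ρ x < 0}) {x : X} (hx : x ∈ frontier Ω)
    (hxU : x ∈ U) : ρ x = 0 := by
  rw [hΩ.frontier_eq] at hx
  apply le_antisymm
  · by_contra! hpos
    have h1 := (hρ.continuousAt (hU.mem_nhds hxU)).eventually (lt_mem_nhds hpos)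
    obtain ⟨y, ⟨hy1, hy2⟩, hy3⟩ := mem_closure_iff_nhds.1 hx.1 _
      (Filter.inter_mem h1 (hU.mem_nhds hxU))
    have : y ∈ {x ∈ U | ρ x < 0} := h ▸ ⟨hy3, hy2⟩
    exact lt_asymm this.2 hy1
  · by_contra! hneg
    have : x ∈ Ω ∩ U := h ▸ ⟨hxU, hneg⟩
    exact hx.2 this.1

/-- Near a boundary point the frontier lies in the zero set of the defining function. In the chart
this zero set has finite `n`-dimensional measure, and the inverse chart is Lipschitz. Only this
inclusion is needed, not equality with the zero set. -/
theorem isLocallyFiniteMeasure_hypersurfaceArea_restrict {Ω : Set X} (hΩ : IsOpen Ω)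
    (hs : HasSmoothBoundary n Ω) :
    IsLocallyFiniteMeasure ((hypersurfaceArea n X).restrict (frontier Ω)) := by
  refine ⟨fun p => ?_⟩
  by_cases hp : p ∈ frontier Ω
  swap
  · refine ⟨(frontier Ω)ᶜ, isClosed_frontier.isOpen_compl.mem_nhds hp, ?_⟩
    rw [Measure.restrict_apply isClosed_frontier.measurableSet.compl]
    simp
  obtain ⟨U, hU, hpU, ρ, hρ, -, hdρ, hΩU⟩ := hs p hp
  obtain ⟨K, r, hr, hsub, hK⟩ := exists_lipschitzOnWith_chart_symm (n := n) p
  set y₀ := extChartAt (𝓡 (n + 1)) p p with hy₀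
  have hps := mem_extChartAt_source (I := 𝓡 (n + 1)) p
  have hρp : ContMDiffAt (𝓡 (n + 1)) 𝓘(ℝ, ℝ) ∞ ρ p := hρ.contMDiffAt (hU.mem_nhds hpU)
  have hyp : (extChartAt (𝓡 (n + 1)) p).symm y₀ = p := extChartAt_to_inv p
  have hC : ContDiffAt ℝ ∞ (ρ ∘ (extChartAt (𝓡 (n + 1)) p).symm) y₀ := by
    rw [← contMDiffAt_iff_contDiffAt]
    refine ContMDiffAt.comp y₀ (by rw [hyp]; exact hρp) ?_
    exact (contMDiffOn_extChartAt_symm p).contMDiffAt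
      ((isOpen_extChartAt_target p).mem_nhds (mem_extChartAt_target p))
  have hne : fderiv ℝ (ρ ∘ (extChartAt (𝓡 (n + 1)) p).symm) y₀ ≠ 0 := by
    intro h0
    apply hdρ
    ext v
    rw [mvfderiv_chart p hps (hρp.mdifferentiableAt (by simp)), ← hy₀, h0]
    rfl
  obtain ⟨V, hV, hVfin⟩ := exists_nhds_measure_zeroSet_lt_top (d := n) (by simp)
    (hC.hasStrictFDerivAt (by simp)) hne
  have hW : V ∩ Metric.ball y₀ r ∈ 𝓝 y₀ := Filter.inter_mem hV (Metric.ball_mem_nhds _ hr)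
  have hN := Filter.inter_mem (chart_symm_image_mem_nhds p hW) (hU.mem_nhds hpU)
  refine ⟨_, hN, ?_⟩
  rw [Measure.restrict_apply' isClosed_frontier.measurableSet]
  have himg := euclideanHausdorffMeasure_image_lt_top (d := n)
    (hK.mono (Set.inter_subset_right : {y ∈ V | (ρ ∘ (extChartAt (𝓡 (n + 1)) p).symm) y = 0} ∩
      Metric.ball y₀ r ⊆ _)) ((measure_mono Set.inter_subset_left).trans_lt hVfin)
  refine (measure_mono ?_).trans_lt himg
  rintro x ⟨⟨⟨y, hy, rfl⟩, hxU⟩, hxf⟩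
  exact ⟨y, ⟨⟨hy.1, eq_zero_of_mem_frontier hΩ hU hρ.continuousOn hΩU hxf hxU⟩, hy.2⟩, rfl⟩

end LocalGeometry

/-! ### Mollification, partitions of unity and local smoothing of Lipschitz functions. -/

section Smoothing

set_option maxSynthPendingDepth 3
set_option linter.unusedSectionVars false

/-- A mollification is an average of translates, so the Lipschitz constant does not grow. -/
theorem LipschitzWith.exists_contDiff_approx {F : Type*} [NormedAddCommGroup F] [NormedSpace ℝ F]
    [FiniteDimensional ℝ F] {f : F → ℝ} {K : NNReal} (hf : LipschitzWith K f) {δ : ℝ}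
    (hδ : 0 < δ) : ∃ g : F → ℝ, ContDiff ℝ ∞ g ∧ LipschitzWith K g ∧ ∀ x, |g x - f x| ≤ δ := by
  let _ : MeasurableSpace F := borel F
  have : BorelSpace F := ⟨rfl⟩
  let μ : Measure F := Measure.addHaar
  obtain ⟨η, hη, hηδ⟩ : ∃ η : ℝ, 0 < η ∧ K * η ≤ δ := by
    refine ⟨δ / (K + 1), by positivity, ?_⟩
    rw [mul_div_assoc', div_le_iff₀ (by positivity)]
    nlinarith [K.coe_nonneg]
  let φ : ContDiffBump (0 : F) := ⟨η / 2, η, by positivity, by linarith⟩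
  have hc : Continuous f := hf.continuous
  let g : F → ℝ := MeasureTheory.convolution (φ.normed μ) f (ContinuousLinearMap.lsmul ℝ ℝ) μ
  have hint : ∀ x, Integrable (fun t => φ.normed μ t * f (x - t)) μ := fun x =>
    (φ.continuous_normed.mul (hc.comp (continuous_const.sub continuous_id))).integrable_of_hasCompactSupport
      (φ.hasCompactSupport_normed.mul_right)
  refine ⟨g, ?_, ?_, ?_⟩
  · exact φ.hasCompactSupport_normed.contDiff_convolution_left _ φ.contDiff_normed
      hc.locallyIntegrable
  · refine LipschitzWith.of_dist_le_mul fun x y => ?_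
    have h1 : g x - g y = ∫ t, φ.normed μ t * (f (x - t) - f (y - t)) ∂μ := by
      simp only [g, MeasureTheory.convolution, ContinuousLinearMap.lsmul_apply, smul_eq_mul,
        mul_sub]
      exact (integral_sub (hint x) (hint y)).symm
    rw [Real.dist_eq, h1]
    have h2 : ∀ t, ‖φ.normed μ t * (f (x - t) - f (y - t))‖ ≤ φ.normed μ t * (K * dist x y) := by
      intro t
      rw [norm_mul, Real.norm_of_nonneg (φ.nonneg_normed t)]
      refine mul_le_mul_of_nonneg_left ?_ (φ.nonneg_normed t)
      have := hf.dist_le_mul (x - t) (y - t)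
      rwa [dist_sub_right, dist_eq_norm] at this
    have h3 := norm_integral_le_of_norm_le (φ.integrable_normed.mul_const (K * dist x y))
      (Filter.Eventually.of_forall h2)
    rwa [integral_mul_const, φ.integral_normed, one_mul] at h3
  · intro x
    have := φ.dist_normed_convolution_le (μ := μ) (g := f) (x₀ := x) (ε := δ)
      hc.aestronglyMeasurable fun y hy => by
        refine (hf.dist_le_mul y x).trans (le_trans ?_ hηδ)
        gcongr
        exact (Metric.mem_ball.1 hy).le
    rwa [Real.dist_eq] at this

variable {n : ℕ} {X : Type*} [MetricSpace X] [ChartedSpace (EuclideanSpace ℝ (Fin (n + 1))) X]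
  [IsManifold (𝓡 (n + 1)) ∞ X]

theorem mvfderiv_finsetSum {ι : Type*} {I : Finset ι} {f : ι → X → ℝ} {x : X}
    (hf : ∀ i ∈ I, MDifferentiableAt (𝓡 (n + 1)) 𝓘(ℝ, ℝ) (f i) x) :
    MDifferentiableAt (𝓡 (n + 1)) 𝓘(ℝ, ℝ) (fun y => ∑ i ∈ I, f i y) x ∧
    mvfderiv (𝓡 (n + 1)) (fun y => ∑ i ∈ I, f i y) x
      = ∑ i ∈ I, mvfderiv (𝓡 (n + 1)) (f i) x := by
  classical
  induction I using Finset.induction_on with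
  | empty =>
    simp only [Finset.sum_empty]
    exact ⟨mdifferentiableAt_const, mvfderiv_const 0⟩
  | insert a I ha ih =>
    simp only [Finset.sum_insert ha]
    obtain ⟨h1, h2⟩ := ih fun i hi => hf i (Finset.mem_insert_of_mem hi)
    have h3 := hf a (Finset.mem_insert_self a I)
    exact ⟨h3.add h1, by rw [mvfderiv_fun_add h3 h1, h2]⟩

theorem mvfderiv_congr {f g : X → ℝ} {x : X} (h : f =ᶠ[𝓝 x] g) :
    mvfderiv (𝓡 (n + 1)) f x = mvfderiv (𝓡 (n + 1)) g x := by
  ext v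
  have h1 := h.mfderiv_eq (I := 𝓡 (n + 1)) (I' := 𝓘(ℝ, ℝ))
  exact congrArg (fun L => L v) h1

/-- One finite index set serves a whole neighbourhood, so the sum can be differentiated term by
term. -/
theorem SmoothPartitionOfUnity.eventually_finsum_eq {ι : Type*}
    (ρ : SmoothPartitionOfUnity ι (𝓡 (n + 1)) X Set.univ) (f : ι → X → ℝ) (x : X)
    (hf : ∀ i y, ρ i y = 0 → f i y = 0) :
    ∀ᶠ y in 𝓝 x, ∑ᶠ i, f i y = ∑ i ∈ ρ.fintsupport x, f i y := by
  filter_upwards [ρ.eventually_finsupport_subset x] with y hy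
  refine finsum_eq_sum_of_support_subset _ fun i hi => hy ?_
  rw [SmoothPartitionOfUnity.mem_finsupport]
  exact fun h => hi (hf i y h)

theorem IsCompact.exists_bound_of_eventually_le {Y : Type*} [TopologicalSpace Y] {K : Set Y}
    (hK : IsCompact K) {g : Y → ℝ} (hg : ∀ p, ∃ C, ∀ᶠ q in 𝓝 p, g q ≤ C) :
    ∃ C, ∀ q ∈ K, g q ≤ C := by
  refine hK.induction_on ⟨0, by simp⟩ (fun s t hst ⟨C, hC⟩ => ⟨C, fun q hq => hC q (hst hq)⟩)
    (fun s t ⟨C, hC⟩ ⟨D, hD⟩ => ⟨max C D, ?_⟩) fun x _ => ?_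
  · rintro q (hq | hq)
    exacts [(hC q hq).trans (le_max_left _ _), (hD q hq).trans (le_max_right _ _)]
  · obtain ⟨C, hC⟩ := hg x
    exact ⟨_, mem_nhdsWithin_of_mem_nhds hC, C, fun q hq => hq⟩

/-- Indexing by ℕ allows errors of size 2^{-(i+1)} to be assigned to the pieces; compact supports
make the gradient and the measure of each piece finite. -/
theorem exists_countable_partitionOfUnity [SecondCountableTopology X] [Nonempty X] (U : X → Set X)
    (hU : ∀ p, IsOpen (U p)) (hpU : ∀ p, p ∈ U p) :
    ∃ (c : ℕ → X) (ρ : SmoothPartitionOfUnity ℕ (𝓡 (n + 1)) X Set.univ),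
      ρ.IsSubordinate (fun i => U (c i)) ∧ ∀ i, IsCompact (tsupport (ρ i)) := by
  have : LocallyCompactSpace X := Manifold.locallyCompact_of_finiteDimensional (𝓡 (n + 1))
  have : SigmaCompactSpace X := inferInstance
  choose V hV using fun p : X => exists_compact_mem_nhds p
  obtain ⟨T, hT, hTU⟩ := TopologicalSpace.isOpen_iUnion_countable
    (fun p => U p ∩ interior (V p)) fun p => (hU p).inter isOpen_interior
  have hcov : ⋃ p, U p ∩ interior (V p) = Set.univ :=
    Set.eq_univ_of_forall fun p => Set.mem_iUnion.2 ⟨p, hpU p, mem_interior_iff_mem_nhds.2 (hV p).2⟩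
  have hne : T.Nonempty := by
    by_contra h
    rw [Set.not_nonempty_iff_eq_empty] at h
    rw [hcov, h] at hTU
    obtain ⟨x⟩ := ‹Nonempty X›
    simpa using hTU.symm.subset (Set.mem_univ x)
  obtain ⟨c, hc⟩ := hT.exists_eq_range hne
  obtain ⟨ρ, hρ⟩ := SmoothPartitionOfUnity.exists_isSubordinate (𝓡 (n + 1)) isClosed_univ
    (fun i => U (c i) ∩ interior (V (c i))) (fun i => (hU _).inter isOpen_interior) (by
      rw [← hcov, ← hTU, hc, Set.biUnion_range])
  exact ⟨c, ρ, fun i => (hρ i).trans Set.inter_subset_left, fun i =>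
    (hV (c i)).1.of_isClosed_subset (isClosed_tsupport _)
      ((hρ i).trans (Set.inter_subset_right.trans interior_subset))⟩

variable [RiemannianBundle (fun x : X => TangentSpace (𝓡 (n + 1)) x)]
  [IsContMDiffRiemannianBundle (𝓡 (n + 1)) ∞ (EuclideanSpace ℝ (Fin (n + 1)))
      (fun x : X => TangentSpace (𝓡 (n + 1)) x)]

theorem exists_bound_norm_mvfderiv {f : X → ℝ} (hf : ContMDiff (𝓡 (n + 1)) 𝓘(ℝ, ℝ) ∞ f)
    (hc : IsCompact (tsupport f)) : ∃ M : ℝ, 0 ≤ M ∧ ∀ q, ‖mvfderiv (𝓡 (n + 1)) f q‖ ≤ M := by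
  obtain ⟨C, hC⟩ := hc.exists_bound_of_eventually_le (eventually_norm_mvfderiv_le hf)
  refine ⟨max C 0, le_max_right _ _, fun q => ?_⟩
  by_cases hq : q ∈ tsupport f
  · exact (hC q hq).trans (le_max_left _ _)
  · have h0 : f =ᶠ[𝓝 q] fun _ => 0 := by
      filter_upwards [(isClosed_tsupport f).isOpen_compl.mem_nhds hq] with y hy
      exact image_eq_zero_of_notMem_tsupport hy
    rw [mvfderiv_congr h0, mvfderiv_const, norm_zero]
    exact le_max_right _ _

variable [IsRiemannianManifold (𝓡 (n + 1)) X]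

/-- The bound 4 is 2 · 2: the function is 2-Lipschitz in the normalized chart, and the chart
derivative has norm at most 2. The set `U` is independent of `d` and δ, so a partition of unity can
be fixed before δ is chosen. -/
theorem exists_local_contMDiff_approx (p : X) : ∃ U : Set X, IsOpen U ∧ p ∈ U ∧
    ∀ d : X → ℝ, LipschitzWith 1 d → ∀ δ > 0, ∃ h : X → ℝ,
      ContMDiffOn (𝓡 (n + 1)) 𝓘(ℝ, ℝ) ∞ h U ∧
      ∀ q ∈ U, |h q - d q| ≤ δ ∧ ‖mvfderiv (𝓡 (n + 1)) h q‖ ≤ 4 := by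
  obtain ⟨L, ρ, hρ, hsub, hL⟩ := exists_ball_normalized_chart (n := n) p
  set B := Metric.ball (extChartAt (𝓡 (n + 1)) p p) ρ with hB
  refine ⟨(extChartAt (𝓡 (n + 1)) p).source ∩ extChartAt (𝓡 (n + 1)) p ⁻¹' B,
    (continuousOn_extChartAt p).isOpen_inter_preimage (isOpen_extChartAt_source p)
      Metric.isOpen_ball, ⟨mem_extChartAt_source p, Metric.mem_ball_self hρ⟩, ?_⟩
  intro d hd δ hδ
  have hlip : LipschitzOnWith 2 (fun v => d ((extChartAt (𝓡 (n + 1)) p).symm (L.symm v)))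
      (L.symm ⁻¹' B) := by
    refine LipschitzOnWith.of_dist_le_mul fun v hv w hw => ?_
    have h1 := dist_chart_symm_le (L := L.toContinuousLinearMap) zero_le_two (convex_ball _ _)
      hsub (fun y hy => (hL y hy).1) hv hw
    have h2 := hd.dist_le_mul ((extChartAt (𝓡 (n + 1)) p).symm (L.symm v))
      ((extChartAt (𝓡 (n + 1)) p).symm (L.symm w))
    rw [NNReal.coe_one, one_mul] at h2
    refine h2.trans (h1.trans (le_of_eq ?_))
    rw [dist_comm, dist_eq_norm]
    simp
  -- Extension to the whole tangent space with the same constant leaves no boundary to avoid when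
  -- mollifying.
  obtain ⟨f, hf, hfd⟩ := hlip.extend_real
  obtain ⟨g, hg, hgl, hgf⟩ := hf.exists_contDiff_approx hδ
  have hsm : ContMDiffOn (𝓡 (n + 1)) 𝓘(ℝ, ℝ) ∞ (fun q => g (L (extChartAt (𝓡 (n + 1)) p q)))
      (extChartAt (𝓡 (n + 1)) p).source := by
    have h1 := contMDiffOn_extChartAt (I := 𝓡 (n + 1)) (n := ∞) (x := p)
    rw [← extChartAt_source (𝓡 (n + 1))] at h1
    have h2 : ContDiff ℝ ∞ fun y => g (L y) := hg.comp L.contDiff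
    exact h2.contMDiff.comp_contMDiffOn h1
  refine ⟨fun q => g (L (extChartAt (𝓡 (n + 1)) p q)), hsm.mono Set.inter_subset_left, ?_⟩
  rintro q ⟨hqs, hqB⟩
  constructor
  · have h1 := hgf (L (extChartAt (𝓡 (n + 1)) p q))
    rw [← hfd (by simpa using hqB)] at h1
    simpa only [ContinuousLinearEquiv.symm_apply_apply,
      (extChartAt (𝓡 (n + 1)) p).left_inv hqs] using h1
  · refine ContinuousLinearMap.opNorm_le_bound _ (by norm_num) fun v => ?_
    rw [mvfderiv_chart p hqs ((hsm.contMDiffAt ((isOpen_extChartAt_source p).mem_nhds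
      hqs)).mdifferentiableAt (by simp))]
    have h1 : (fun q => g (L (extChartAt (𝓡 (n + 1)) p q))) ∘ (extChartAt (𝓡 (n + 1)) p).symm
        =ᶠ[𝓝 (extChartAt (𝓡 (n + 1)) p q)] fun y => g (L y) := by
      filter_upwards [(isOpen_extChartAt_target (I := 𝓡 (n + 1)) p).mem_nhds (hsub hqB)] with y hy
      simp only [Function.comp_apply, (extChartAt (𝓡 (n + 1)) p).right_inv hy]
    have h2 : HasFDerivAt (fun y => g (L y)) ((fderiv ℝ g (L (extChartAt (𝓡 (n + 1)) p q))).comp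
        L.toContinuousLinearMap) (extChartAt (𝓡 (n + 1)) p q) :=
      ((hg.differentiable (by simp)) _).hasFDerivAt.comp _ L.toContinuousLinearMap.hasFDerivAt
    rw [h1.fderiv_eq, h2.fderiv]
    have h3 := (hL _ hqB).2
    rw [(extChartAt (𝓡 (n + 1)) p).left_inv hqs] at h3
    have h4 := ContinuousLinearMap.le_of_opNorm_le _
      (norm_fderiv_le_of_lipschitz ℝ hgl (x₀ := L (extChartAt (𝓡 (n + 1)) p q)))
      (L (chartDeriv p q v))
    refine h4.trans ?_
    have h5 := h3 v
    push_cast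
    linarith

end Smoothing

/-! ### Global smoothing, and a small positive function. -/

section GlobalApprox

set_option maxSynthPendingDepth 3
set_option linter.unusedSectionVars false

variable {n : ℕ} {X : Type*} [MetricSpace X] [ChartedSpace (EuclideanSpace ℝ (Fin (n + 1))) X]
  [IsManifold (𝓡 (n + 1)) ∞ X] [SecondCountableTopology X] [Nonempty X]
  [RiemannianBundle (fun x : X => TangentSpace (𝓡 (n + 1)) x)]
  [IsContMDiffRiemannianBundle (𝓡 (n + 1)) ∞ (EuclideanSpace ℝ (Fin (n + 1)))
      (fun x : X => TangentSpace (𝓡 (n + 1)) x)]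

theorem sum_half_pow_succ_le (I : Finset ℕ) : ∑ i ∈ I, (1 / 2 : ℝ) ^ (i + 1) ≤ 1 := by
  have hs : Summable fun i : ℕ => (1 / 2 : ℝ) ^ (i + 1) := by
    simpa only [pow_succ] using summable_geometric_two.mul_right (1 / 2 : ℝ)
  refine (hs.sum_le_tsum I fun i _ => by positivity).trans (le_of_eq ?_)
  simp only [pow_succ]
  rw [tsum_mul_right, tsum_geometric_two]
  norm_num

/-- Glue local approximations hᵢ by a partition of unity. Because ∑ ∇ρᵢ = 0, the gradient is ∑ ρᵢ
∇hᵢ + ∑ (hᵢ - d) ∇ρᵢ. The first sum is at most 4, and the second at most ∑ 2^{-(i+1)} ≤ 1. -/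
theorem exists_contMDiff_approx_of_lipschitz [IsRiemannianManifold (𝓡 (n + 1)) X] {d : X → ℝ}
    (hd : LipschitzWith 1 d) {δ : ℝ} (hδ : 0 < δ) :
    ∃ h : X → ℝ, ContMDiff (𝓡 (n + 1)) 𝓘(ℝ, ℝ) ∞ h ∧ ∀ q, |h q - d q| ≤ δ ∧
      ‖mvfderiv (𝓡 (n + 1)) h q‖ ≤ 5 := by
  choose U hU hpU happ using exists_local_contMDiff_approx (n := n) (X := X)
  obtain ⟨c, ρ, hρU, hρc⟩ := exists_countable_partitionOfUnity (n := n) U hU hpU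
  choose M hM0 hM using fun i => exists_bound_norm_mvfderiv (n := n) (ρ i).contMDiff (hρc i)
  -- The accuracy on the i-th piece is tuned to the bound `M i` for |∇ρᵢ|.
  choose h hsm hclose using fun i => happ (c i) d hd (min δ ((1 / 2) ^ (i + 1) / (1 + M i)))
    (lt_min hδ (div_pos (by positivity) (by linarith [hM0 i])))
  have hsm' : ∀ i, ∀ x ∈ tsupport (ρ i), ContMDiffAt (𝓡 (n + 1)) 𝓘(ℝ, ℝ) ∞ (h i) x :=
    fun i x hx => (hsm i).contMDiffAt ((hU _).mem_nhds (hρU i hx))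
  refine ⟨fun x => ∑ᶠ i, ρ i x • h i x, ρ.contMDiff_finsum_smul hsm', fun q => ⟨?_, ?_⟩⟩
  · have := ρ.finsum_smul_mem_convex (g := h) (t := Metric.closedBall (d q) δ) (Set.mem_univ q)
      (fun i hi => by
        rw [Metric.mem_closedBall, Real.dist_eq]
        exact ((hclose i q (hρU i (subset_tsupport _ hi))).1).trans (min_le_left _ _))
      (convex_closedBall _ _)
    rwa [Metric.mem_closedBall, Real.dist_eq] at this
  · set I := ρ.fintsupport q with hI
    have hIm : ∀ i ∈ I, q ∈ tsupport (ρ i) := fun i hi => (ρ.mem_fintsupport_iff q i).1 hi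
    have hρd : ∀ i, MDifferentiableAt (𝓡 (n + 1)) 𝓘(ℝ, ℝ) (ρ i) q :=
      fun i => (ρ i).contMDiff.contMDiffAt.mdifferentiableAt (by simp)
    have hhd : ∀ i ∈ I, MDifferentiableAt (𝓡 (n + 1)) 𝓘(ℝ, ℝ) (h i) q :=
      fun i hi => (hsm' i q (hIm i hi)).mdifferentiableAt (by simp)
    have e1 := ρ.eventually_finsum_eq (fun i y => ρ i y • h i y) q fun i y hy => by simp [hy]
    have e2 := ρ.eventually_finsum_eq (fun i y => ρ i y) q fun i y hy => hy
    have hsum1 : ∑ i ∈ I, ρ i q = 1 := by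
      rw [← e2.self_of_nhds, ρ.sum_eq_one (Set.mem_univ q)]
    have hsum0 : ∑ i ∈ I, mvfderiv (𝓡 (n + 1)) (ρ i) q = 0 := by
      rw [← (mvfderiv_finsetSum fun i _ => hρd i).2]
      rw [mvfderiv_congr (g := fun _ => (1 : ℝ))]
      · exact mvfderiv_const 1
      · filter_upwards [e2] with y hy
        rw [← hy, ρ.sum_eq_one (Set.mem_univ y)]
    have hder : mvfderiv (𝓡 (n + 1)) (fun x => ∑ᶠ i, ρ i x • h i x) q
        = ∑ i ∈ I, (ρ i q • mvfderiv (𝓡 (n + 1)) (h i) q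
          + (h i q - d q) • mvfderiv (𝓡 (n + 1)) (ρ i) q) := by
      refine (mvfderiv_congr e1).trans ((mvfderiv_finsetSum (f := fun i y => ρ i y • h i y)
        fun i hi => (hρd i).mul (hhd i hi)).2.trans ?_)
      simp only [sub_smul, ← add_sub_assoc, Finset.sum_sub_distrib, ← Finset.smul_sum, hsum0,
        smul_zero, sub_zero]
      exact Finset.sum_congr rfl fun i hi => mvfderiv_fun_mul (hρd i) (hhd i hi)
    rw [hder]
    have hterm : ∀ i ∈ I, ‖ρ i q • mvfderiv (𝓡 (n + 1)) (h i) q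
          + (h i q - d q) • mvfderiv (𝓡 (n + 1)) (ρ i) q‖ ≤ ρ i q * 4 + (1 / 2) ^ (i + 1) := by
      intro i hi
      obtain ⟨k1, k2⟩ := hclose i q (hρU i (hIm i hi))
      refine (norm_add_le _ _).trans (add_le_add ?_ ?_)
      · rw [norm_smul, Real.norm_of_nonneg (ρ.nonneg i q)]
        exact mul_le_mul_of_nonneg_left k2 (ρ.nonneg i q)
      · rw [norm_smul, Real.norm_eq_abs]
        have hM1 : 0 < 1 + M i := by linarith [hM0 i]
        calc _ ≤ (1 / 2 : ℝ) ^ (i + 1) / (1 + M i) * (1 + M i) := by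
              refine mul_le_mul (k1.trans (min_le_right _ _)) ((hM i q).trans (by linarith))
                (norm_nonneg _) (by positivity)
          _ = _ := by field_simp
    refine (norm_sum_le_of_le I hterm).trans ?_
    rw [Finset.sum_add_distrib, ← Finset.sum_mul, hsum1]
    linarith [sum_half_pow_succ_le I]

/-- Take s = ∑ αᵢ² ρᵢ² and k = ∑ αᵢ² |∇ρᵢ|², so that Cauchy–Schwarz gives |∇s|² ≤ 4sk. The three
dominated quantities are those needed later: √s for s log s, k for |∇s|²/s, and A s for the
curvature and boundary terms. The majorant `H` is a sum of indicators, so no measurability of `k` or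
`A` is required. -/
theorem exists_contMDiff_pos_small [MeasurableSpace X] [BorelSpace X] (μ : Measure X)
    [IsLocallyFiniteMeasure μ] {A : X → ℝ}
    (hA : ∀ p, ∃ C, ∀ᶠ q in 𝓝 p, A q ≤ C) {ε : ℝ} (hε : 0 < ε) :
    ∃ (s k : X → ℝ) (H : X → ENNReal), ContMDiff (𝓡 (n + 1)) 𝓘(ℝ, ℝ) ∞ s ∧ Measurable H ∧
      ∫⁻ x, H x ∂μ ≤ ENNReal.ofReal ε ∧ ∀ x, 0 < s x ∧ s x ≤ 1 ∧ 0 ≤ k x ∧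
        ‖mvfderiv (𝓡 (n + 1)) s x‖ ^ 2 ≤ 4 * s x * k x ∧
        ENNReal.ofReal (√(s x) + k x + A x * s x) ≤ H x := by
  obtain ⟨c, ρ, -, hρc⟩ := exists_countable_partitionOfUnity (n := n) (X := X)
    (fun _ => Set.univ) (fun _ => isOpen_univ) fun _ => Set.mem_univ _
  choose M hM0 hM using fun i => exists_bound_norm_mvfderiv (n := n) (ρ i).contMDiff (hρc i)
  choose D hD using fun i => (hρc i).exists_bound_of_eventually_le hA
  let w : ℕ → ℝ := fun i => 1 + M i ^ 2 + |D i|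
  let m : ℕ → ℝ := fun i => (μ (tsupport (ρ i))).toReal
  have hw : ∀ i, 0 < w i := fun i => by positivity
  have hm : ∀ i, 0 ≤ m i := fun i => ENNReal.toReal_nonneg
  -- The i-th piece contributes at most αᵢ wᵢ mᵢ to ∫ H; the cap 1 gives αᵢ² ≤ αᵢ. The added 1
  -- avoids dividing by zero.
  let α : ℕ → ℝ := fun i => min 1 (ε * (1 / 2) ^ (i + 1) / (w i * (1 + m i)))
  have hα0 : ∀ i, 0 < α i := fun i => lt_min one_pos (div_pos (by positivity)
    (mul_pos (hw i) (by linarith [hm i])))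
  have hα1 : ∀ i, α i ≤ 1 := fun i => min_le_left _ _
  have hαw : ∀ i, α i * w i * m i ≤ ε * (1 / 2) ^ (i + 1) := by
    intro i
    have h1 : 0 < w i * (1 + m i) := mul_pos (hw i) (by linarith [hm i])
    have h2 := (le_div_iff₀ h1).1 (min_le_right 1 (ε * (1 / 2) ^ (i + 1) / (w i * (1 + m i))))
    refine le_trans ?_ h2
    have h3 := mul_pos (hα0 i) (hw i)
    change _ ≤ α i * (w i * (1 + m i))
    nlinarith
  -- Written as a partition-of-unity combination of the functions αᵢ² ρᵢ, so that smoothness is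
  -- immediate.
  let s : X → ℝ := fun x => ∑ᶠ i, ρ i x • (α i ^ 2 * ρ i x)
  let k : X → ℝ := fun x => ∑ i ∈ ρ.fintsupport x, α i ^ 2 * ‖mvfderiv (𝓡 (n + 1)) (ρ i) x‖ ^ 2
  let H : X → ENNReal := fun x =>
    ∑' i, (tsupport (ρ i)).indicator (fun _ => ENNReal.ofReal (α i * w i)) x
  have hs : ContMDiff (𝓡 (n + 1)) 𝓘(ℝ, ℝ) ∞ s :=
    ρ.contMDiff_finsum_smul fun i x _ => (contMDiff_const.mul (ρ i).contMDiff).contMDiffAt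
  have hmeas : ∀ i, Measurable ((tsupport (ρ i)).indicator fun _ => ENNReal.ofReal (α i * w i)) :=
    fun i => measurable_const.indicator (isClosed_tsupport _).measurableSet
  refine ⟨s, k, H, hs, Measurable.tsum hmeas, ?_, ?_⟩
  · simp only [H]
    rw [lintegral_tsum fun i => (hmeas i).aemeasurable]
    have h1 : ∀ i, ∫⁻ x, (tsupport (ρ i)).indicator (fun _ => ENNReal.ofReal (α i * w i)) x ∂μ
        ≤ ENNReal.ofReal (ε * (1 / 2) ^ (i + 1)) := by
      intro i
      rw [lintegral_indicator_const (isClosed_tsupport _).measurableSet,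
        ← ENNReal.ofReal_toReal (hρc i).measure_lt_top.ne,
        ← ENNReal.ofReal_mul (mul_pos (hα0 i) (hw i)).le]
      exact ENNReal.ofReal_le_ofReal (hαw i)
    refine (ENNReal.tsum_le_tsum h1).trans ?_
    rw [ENNReal.tsum_eq_iSup_sum]
    refine iSup_le fun I => ?_
    rw [← ENNReal.ofReal_sum_of_nonneg fun i _ => by positivity, ← Finset.mul_sum]
    exact ENNReal.ofReal_le_ofReal (by nlinarith [sum_half_pow_succ_le I])
  intro x
  set I := ρ.fintsupport x with hI
  have hIm : ∀ i ∈ I, x ∈ tsupport (ρ i) := fun i hi => (ρ.mem_fintsupport_iff x i).1 hi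
  have hρ0 : ∀ i, 0 ≤ ρ i x := fun i => ρ.nonneg i x
  have hρ1 : ∀ i, ρ i x ≤ 1 := fun i => ρ.le_one i x
  have e1 := ρ.eventually_finsum_eq (fun i y => ρ i y • (α i ^ 2 * ρ i y)) x
    fun i y hy => by simp [hy]
  have e2 := ρ.eventually_finsum_eq (fun i y => ρ i y) x fun i y hy => hy
  have hsum1 : ∑ i ∈ I, ρ i x = 1 := by
    rw [← e2.self_of_nhds, ρ.sum_eq_one (Set.mem_univ x)]
  have hsx : s x = ∑ i ∈ I, (α i * ρ i x) ^ 2 := by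
    simp only [s]
    rw [e1.self_of_nhds]
    exact Finset.sum_congr rfl fun i _ => by rw [smul_eq_mul]; ring
  have hkx : k x = ∑ i ∈ I, (α i * ‖mvfderiv (𝓡 (n + 1)) (ρ i) x‖) ^ 2 :=
    Finset.sum_congr rfl fun i _ => by rw [mul_pow]
  have hρd : ∀ i, MDifferentiableAt (𝓡 (n + 1)) 𝓘(ℝ, ℝ) (ρ i) x :=
    fun i => (ρ i).contMDiff.contMDiffAt.mdifferentiableAt (by simp)
  have hder : mvfderiv (𝓡 (n + 1)) s x
      = ∑ i ∈ I, (2 * α i ^ 2 * ρ i x) • mvfderiv (𝓡 (n + 1)) (ρ i) x := by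
    refine (mvfderiv_congr e1).trans ((mvfderiv_finsetSum
      (f := fun i y => ρ i y • (α i ^ 2 * ρ i y)) fun i _ =>
      (hρd i).mul (mdifferentiableAt_const.mul (hρd i))).2.trans ?_)
    refine Finset.sum_congr rfl fun i _ => ?_
    have h1 := mvfderiv_fun_mul (hρd i) (mdifferentiableAt_const.mul (hρd i) :
      MDifferentiableAt (𝓡 (n + 1)) 𝓘(ℝ, ℝ) (fun y => α i ^ 2 * ρ i y) x)
    have h2 := mvfderiv_fun_mul (mdifferentiableAt_const :
      MDifferentiableAt (𝓡 (n + 1)) 𝓘(ℝ, ℝ) (fun _ : X => α i ^ 2) x) (hρd i)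
    refine h1.trans ?_
    have h3 : mvfderiv (𝓡 (n + 1)) ((fun _ : X => α i ^ 2) * ⇑(ρ i)) x = _ := h2
    rw [h3, mvfderiv_const]
    ext v
    simp
    ring
  have hle : ∀ i, α i ^ 2 ≤ α i := fun i => by nlinarith [hα0 i, hα1 i]
  have hspos : 0 < s x := by
    obtain ⟨j, hj⟩ := ρ.exists_pos_of_mem (Set.mem_univ x)
    rw [hsx]
    exact Finset.sum_pos' (fun i _ => sq_nonneg _)
      ⟨j, (ρ.mem_fintsupport_iff x j).2 (subset_tsupport _ hj.ne'),
        pow_pos (mul_pos (hα0 j) hj) 2⟩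
  refine ⟨hspos, ?_, ?_, ?_, ?_⟩
  · rw [hsx, ← hsum1]
    refine Finset.sum_le_sum fun i _ => ?_
    have h1 : α i * ρ i x ≤ 1 * 1 := mul_le_mul (hα1 i) (hρ1 i) (hρ0 i) zero_le_one
    have h2 : 0 ≤ α i * ρ i x := mul_nonneg (hα0 i).le (hρ0 i)
    have h3 : α i * ρ i x ≤ ρ i x := mul_le_of_le_one_left (hρ0 i) (hα1 i)
    nlinarith
  · exact Finset.sum_nonneg fun i _ => by positivity
  · have h1 : ‖mvfderiv (𝓡 (n + 1)) s x‖ ≤ 2 * ∑ i ∈ I, (α i * ρ i x)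
        * (α i * ‖mvfderiv (𝓡 (n + 1)) (ρ i) x‖) := by
      rw [hder, Finset.mul_sum]
      refine norm_sum_le_of_le I fun i _ => ?_
      rw [norm_smul, Real.norm_of_nonneg (by have := hρ0 i; positivity)]
      exact le_of_eq (by ring)
    have h2 := Finset.sum_mul_sq_le_sq_mul_sq I (fun i => α i * ρ i x)
      (fun i => α i * ‖mvfderiv (𝓡 (n + 1)) (ρ i) x‖)
    rw [← hsx, ← hkx] at h2
    have h3 := pow_le_pow_left₀ (norm_nonneg _) h1 2
    nlinarith
  · have h1 : √(s x) ≤ ∑ i ∈ I, α i := by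
      refine Real.sqrt_le_iff.2 ⟨Finset.sum_nonneg fun i _ => (hα0 i).le, ?_⟩
      rw [hsx]
      refine (Finset.sum_le_sum (g := fun i => α i ^ 2) fun i _ => ?_).trans
        (Finset.sum_sq_le_sq_sum_of_nonneg fun i _ => (hα0 i).le)
      have := hρ0 i
      have := hα0 i
      exact pow_le_pow_left₀ (by positivity) (mul_le_of_le_one_right (hα0 i).le (hρ1 i)) 2
    have h2 : k x ≤ ∑ i ∈ I, α i * M i ^ 2 := by
      refine Finset.sum_le_sum fun i _ => ?_
      exact mul_le_mul (hle i) (pow_le_pow_left₀ (norm_nonneg _) (hM i x) 2) (by positivity)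
        (hα0 i).le
    have h3 : A x * s x ≤ ∑ i ∈ I, α i * |D i| := by
      rw [hsx, Finset.mul_sum]
      refine Finset.sum_le_sum fun i hi => ?_
      have k1 : A x ≤ |D i| := (hD i x (hIm i hi)).trans (le_abs_self _)
      have k2 : (α i * ρ i x) ^ 2 ≤ α i := by
        refine le_trans (pow_le_pow_left₀ (mul_nonneg (hα0 i).le (hρ0 i))
          (mul_le_of_le_one_right (hα0 i).le (hρ1 i)) 2) (hle i)
      rw [mul_comm (α i) |D i|]
      exact mul_le_mul k1 k2 (sq_nonneg _) (abs_nonneg _)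
    have h4 : √(s x) + k x + A x * s x ≤ ∑ i ∈ I, α i * w i := by
      have : ∑ i ∈ I, α i * w i = ∑ i ∈ I, α i + ∑ i ∈ I, α i * M i ^ 2
          + ∑ i ∈ I, α i * |D i| := by
        rw [← Finset.sum_add_distrib, ← Finset.sum_add_distrib]
        exact Finset.sum_congr rfl fun i _ => by simp only [w]; ring
      linarith
    refine (ENNReal.ofReal_le_ofReal h4).trans ?_
    rw [ENNReal.ofReal_sum_of_nonneg fun i _ => (mul_pos (hα0 i) (hw i)).le]
    refine le_trans (le_of_eq (Finset.sum_congr rfl fun i hi => ?_)) (ENNReal.sum_le_tsum I)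
    rw [Set.indicator_of_mem (hIm i hi)]

end GlobalApprox

/-! ### Elementary estimates in one variable and for integrals. -/

section Estimates

/-- The thresholds are 1/2 + 1/8 and 1 - 1/8, leaving room for an error r/8 in the approximate
distance. -/
theorem exists_smooth_cutoff : ∃ (χ : ℝ → ℝ) (K : ℝ), ContDiff ℝ ∞ χ ∧ 0 ≤ K ∧
    (∀ t, 0 ≤ χ t ∧ χ t ≤ 1 ∧ |deriv χ t| ≤ K) ∧ (∀ t ≤ 5 / 8, χ t = 1) ∧
    ∀ t, 7 / 8 ≤ t → χ t = 0 ∧ deriv χ t = 0 := by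
  let χ : ℝ → ℝ := fun t => Real.smoothTransition ((7 / 8 - t) * 4)
  have hχ : ContDiff ℝ ∞ χ :=
    Real.smoothTransition.contDiff.comp ((contDiff_const.sub contDiff_id).mul contDiff_const)
  have h0 : ∀ t, 0 ≤ χ t := fun t => Real.smoothTransition.nonneg _
  have h1 : ∀ t, χ t ≤ 1 := fun t => Real.smoothTransition.le_one _
  have hone : ∀ t ≤ 5 / 8, χ t = 1 :=
    fun t ht => Real.smoothTransition.one_of_one_le (by linarith)
  have hzero : ∀ t, 7 / 8 ≤ t → χ t = 0 :=
    fun t ht => Real.smoothTransition.zero_of_nonpos (by linarith)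
  -- Zeros of a nonnegative function are minima, which covers the endpoint as well.
  have hd0 : ∀ t, 7 / 8 ≤ t → deriv χ t = 0 := fun t ht =>
    IsLocalMin.deriv_eq_zero (Filter.Eventually.of_forall fun y => (hzero t ht).trans_le (h0 y))
  have hd1 : ∀ t ≤ 5 / 8, deriv χ t = 0 := fun t ht =>
    IsLocalMax.deriv_eq_zero (Filter.Eventually.of_forall fun y => (h1 y).trans (hone t ht).ge)
  obtain ⟨K, hK⟩ := isCompact_Icc.exists_bound_of_continuousOn (s := Set.Icc (5 / 8 : ℝ) (7 / 8))
    (hχ.continuous_deriv (by simp)).continuousOn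
  have hK0 : 0 ≤ K := (norm_nonneg _).trans (hK (5 / 8) ⟨le_rfl, by norm_num⟩)
  refine ⟨χ, K, hχ, hK0, fun t => ⟨h0 t, h1 t, ?_⟩, hone, fun t ht => ⟨hzero t ht, hd0 t ht⟩⟩
  rcases le_total t (5 / 8) with h | h
  · rw [hd1 t h, abs_zero]; exact hK0
  rcases le_total (7 / 8) t with h' | h'
  · rw [hd0 t h', abs_zero]; exact hK0
  · exact hK t ⟨h, h'⟩

theorem abs_mul_log_le_two {x : ℝ} (h0 : 0 < x) (h2 : x ≤ 2) : |x * Real.log x| ≤ 2 := by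
  have h3 := Real.log_le_sub_one_of_pos h0
  have h4 := Real.one_sub_inv_le_log_of_pos h0
  have h5 : x * (1 - x⁻¹) = x - 1 := by field_simp
  rw [abs_le]
  constructor <;> nlinarith

/-- From log √x ≥ 1 - 1/√x. This makes s log s integrable as soon as √s is. -/
theorem abs_mul_log_le_sqrt {x : ℝ} (h0 : 0 < x) (h1 : x ≤ 1) :
    |x * Real.log x| ≤ 2 * √x := by
  have h2 : 0 < √x := Real.sqrt_pos.2 h0
  have h3 := Real.one_sub_inv_le_log_of_pos h2
  rw [Real.log_sqrt h0.le] at h3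
  have h4 : √x * √x = x := Real.mul_self_sqrt h0.le
  have h5 : x * (√x)⁻¹ = √x := by field_simp; linarith
  have h6 := Real.log_nonpos h0.le h1
  rw [abs_le]
  constructor
  · nlinarith
  · nlinarith

theorem abs_sum_sum_le_card_sq_mul_sqrt {ι : Type*} [Fintype ι] (T : ι → ι → ι → ι → ℝ) :
    |∑ i, ∑ j, T i j j i| ≤ (Fintype.card ι : ℝ) ^ 2 * √(∑ i, ∑ j, ∑ k, ∑ l, T i j k l ^ 2) := by
  set N := √(∑ i, ∑ j, ∑ k, ∑ l, T i j k l ^ 2) with hN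
  have hterm : ∀ i j, |T i j j i| ≤ N := by
    intro i j
    refine Real.abs_le_sqrt ?_
    have h1 := Finset.single_le_sum (f := fun l => T i j j l ^ 2)
      (fun l _ => sq_nonneg _) (Finset.mem_univ i)
    have h2 := Finset.single_le_sum (f := fun k => ∑ l, T i j k l ^ 2)
      (fun l _ => by positivity) (Finset.mem_univ j)
    have h3 := Finset.single_le_sum (f := fun j => ∑ k, ∑ l, T i j k l ^ 2)
      (fun l _ => by positivity) (Finset.mem_univ j)
    have h4 := Finset.single_le_sum (f := fun i => ∑ j, ∑ k, ∑ l, T i j k l ^ 2)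
      (fun l _ => by positivity) (Finset.mem_univ i)
    exact h1.trans (h2.trans (h3.trans h4))
  calc |∑ i, ∑ j, T i j j i| ≤ ∑ i, ∑ j, |T i j j i| :=
        (Finset.abs_sum_le_sum_abs _ _).trans
          (Finset.sum_le_sum fun i _ => Finset.abs_sum_le_sum_abs _ _)
    _ ≤ ∑ _i : ι, ∑ _j : ι, N :=
        Finset.sum_le_sum fun i _ => Finset.sum_le_sum fun j _ => hterm i j
    _ = (Fintype.card ι : ℝ) ^ 2 * N := by
        simp only [Finset.sum_const, Finset.card_univ, nsmul_eq_mul]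
        ring

/-- The common pattern of the five test-function estimates: `G` accounts for the cutoff inside the
ball, and `H` for the tail s everywhere. -/
theorem integrable_and_integral_abs_le {α : Type*} [MeasurableSpace α] {m : Measure α}
    {F : α → ℝ} (hF : AEStronglyMeasurable F m) {B : Set α} (hB : MeasurableSet B)
    {G H : α → ENNReal} (hH : Measurable H) {a b D : ℝ} (ha : 0 ≤ a) (hb : 0 ≤ b) (hD : 0 ≤ D)
    (hGa : ∫⁻ x in B, G x ∂m ≤ ENNReal.ofReal a) (hHb : ∫⁻ x, H x ∂m ≤ ENNReal.ofReal b)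
    (hle : ∀ᵐ x ∂m, ENNReal.ofReal |F x| ≤ B.indicator G x + ENNReal.ofReal D * H x) :
    Integrable F m ∧ ∫ x, |F x| ∂m ≤ a + D * b := by
  have h1 : ∫⁻ x, ENNReal.ofReal |F x| ∂m ≤ ENNReal.ofReal (a + D * b) := by
    refine (lintegral_mono_ae hle).trans ?_
    rw [lintegral_add_right _ (hH.const_mul _), lintegral_indicator hB,
      lintegral_const_mul _ hH, ENNReal.ofReal_add ha (mul_nonneg hD hb), ENNReal.ofReal_mul hD]
    gcongr
  have h2 : Integrable F m := by
    refine ⟨hF, ?_⟩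
    rw [hasFiniteIntegral_iff_norm]
    exact h1.trans_lt ENNReal.ofReal_lt_top
  refine ⟨h2, ?_⟩
  rw [integral_eq_lintegral_of_nonneg_ae (Filter.Eventually.of_forall fun x => abs_nonneg _)
    h2.abs.aestronglyMeasurable]
  exact ENNReal.toReal_le_of_le_ofReal (by positivity) h1

end Estimates

/-! ### The scalar curvature bound and smooth cutoffs of metric balls. -/

section Manifold

set_option maxSynthPendingDepth 3
set_option linter.unusedSectionVars false

variable {n : ℕ} {X : Type*} [MetricSpace X] [ChartedSpace (EuclideanSpace ℝ (Fin (n + 1))) X]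
  [IsManifold (𝓡 (n + 1)) ∞ X]

theorem mvfderiv_comp_real {g : ℝ → ℝ} {f : X → ℝ} {x : X} (hg : DifferentiableAt ℝ g (f x))
    (hf : MDifferentiableAt (𝓡 (n + 1)) 𝓘(ℝ, ℝ) f x) :
    mvfderiv (𝓡 (n + 1)) (fun y => g (f y)) x = deriv g (f x) • mvfderiv (𝓡 (n + 1)) f x := by
  have h := mvfderiv_comp (I := 𝓘(ℝ, ℝ)) x hg.mdifferentiableAt hf
  refine h.trans ?_
  ext v
  change mfderiv 𝓘(ℝ, ℝ) 𝓘(ℝ, ℝ) g (f x) (mvfderiv (𝓡 (n + 1)) f x v) = _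
  rw [mfderiv_eq_fderiv]
  refine (fderiv_eq_smul_deriv (mvfderiv (𝓡 (n + 1)) f x v)).trans ?_
  exact mul_comm (mvfderiv (𝓡 (n + 1)) f x v) _

variable [RiemannianBundle (fun x : X => TangentSpace (𝓡 (n + 1)) x)]

theorem abs_scalarCurvature_le (q : X) :
    |scalarCurvature n q| ≤ ((n : ℝ) + 1) ^ 2 * riemannNorm n q := by
  have hfin : Module.finrank ℝ (TangentSpace (𝓡 (n + 1)) q) = n + 1 :=
    (finrank_euclideanSpace_fin : Module.finrank ℝ (EuclideanSpace ℝ (Fin (n + 1))) = n + 1)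
  have h := abs_sum_sum_le_card_sq_mul_sqrt fun i j k l =>
    riemannTensor q (stdOrthonormalBasis ℝ (TangentSpace (𝓡 (n + 1)) q) i)
      (stdOrthonormalBasis ℝ (TangentSpace (𝓡 (n + 1)) q) j)
      (stdOrthonormalBasis ℝ (TangentSpace (𝓡 (n + 1)) q) k)
      (stdOrthonormalBasis ℝ (TangentSpace (𝓡 (n + 1)) q) l)
  have hcard : (Fintype.card (Fin (Module.finrank ℝ (TangentSpace (𝓡 (n + 1)) q))) : ℝ)
      = (n : ℝ) + 1 := by
    rw [Fintype.card_fin, hfin, Nat.cast_add, Nat.cast_one]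
  rw [← hcard]
  exact h

variable [IsContMDiffRiemannianBundle (𝓡 (n + 1)) ∞ (EuclideanSpace ℝ (Fin (n + 1)))
      (fun x : X => TangentSpace (𝓡 (n + 1)) x)] [IsRiemannianManifold (𝓡 (n + 1)) X]
  [SecondCountableTopology X] [Nonempty X]

theorem exists_contMDiff_cutoff_ball {χ : ℝ → ℝ} {K : ℝ} (hχ : ContDiff ℝ ∞ χ)
    (hχK : ∀ t, 0 ≤ χ t ∧ χ t ≤ 1 ∧ |deriv χ t| ≤ K) (hχ1 : ∀ t ≤ 5 / 8, χ t = 1)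
    (hχ0 : ∀ t, 7 / 8 ≤ t → χ t = 0 ∧ deriv χ t = 0) (x₀ : X) {r : ℝ} (hr : 0 < r) :
    ∃ φ : X → ℝ, ContMDiff (𝓡 (n + 1)) 𝓘(ℝ, ℝ) ∞ φ ∧
      (∀ x, 0 ≤ φ x ∧ φ x ≤ 1 ∧ ‖mvfderiv (𝓡 (n + 1)) φ x‖ ≤ 5 * K / r) ∧
      (∀ x ∈ Metric.ball x₀ (r / 2), φ x = 1) ∧
      ∀ x ∉ Metric.ball x₀ r, φ x = 0 ∧ mvfderiv (𝓡 (n + 1)) φ x = 0 := by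
  obtain ⟨h, hh, hd⟩ := exists_contMDiff_approx_of_lipschitz (n := n)
    (LipschitzWith.dist_left x₀ : LipschitzWith 1 fun x : X => dist x x₀)
    (δ := r / 8) (by positivity)
  let g : ℝ → ℝ := fun t => χ (r⁻¹ * t)
  have hg : ContDiff ℝ ∞ g := hχ.comp (contDiff_const.mul contDiff_id)
  have hgd : ∀ t, deriv g t = r⁻¹ * deriv χ (r⁻¹ * t) := fun t => by
    simp only [g]
    rw [deriv_comp_mul_left, smul_eq_mul]
  have hφd : ∀ x, mvfderiv (𝓡 (n + 1)) (fun y => g (h y)) x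
      = (r⁻¹ * deriv χ (r⁻¹ * h x)) • mvfderiv (𝓡 (n + 1)) h x := fun x => by
    rw [mvfderiv_comp_real (hg.differentiable (by simp) _)
      (hh.contMDiffAt.mdifferentiableAt (by simp)), hgd]
  refine ⟨fun x => g (h x), hg.contMDiff.comp hh, fun x => ⟨(hχK _).1, (hχK _).2.1, ?_⟩, ?_, ?_⟩
  · rw [hφd, norm_smul, Real.norm_eq_abs, abs_mul, abs_of_pos (inv_pos.2 hr)]
    have h1 := (hχK (r⁻¹ * h x)).2.2
    have h2 := (hd x).2
    calc r⁻¹ * |deriv χ (r⁻¹ * h x)| * ‖mvfderiv (𝓡 (n + 1)) h x‖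
        ≤ r⁻¹ * K * 5 := by
          refine mul_le_mul (mul_le_mul_of_nonneg_left h1 (inv_pos.2 hr).le) h2 (norm_nonneg _) ?_
          exact mul_nonneg (inv_pos.2 hr).le ((abs_nonneg _).trans h1)
      _ = 5 * K / r := by field_simp
  · intro x hx
    have h1 := abs_le.1 (hd x).1
    have h2 := Metric.mem_ball.1 hx
    refine hχ1 _ ?_
    rw [inv_mul_le_iff₀ hr]
    linarith [h1.2]
  · intro x hx
    have h1 := abs_le.1 (hd x).1
    have h2 := not_lt.1 fun h => hx (Metric.mem_ball.2 h)
    have h3 : 7 / 8 ≤ r⁻¹ * h x := by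
      rw [le_inv_mul_iff₀ hr]
      linarith [h1.1]
    refine ⟨(hχ0 _ h3).1, ?_⟩
    rw [hφd, (hχ0 _ h3).2, mul_zero, zero_smul]

end Manifold

/-! ### The test density φ² + s and its integrals. -/

section TestFunction

theorem isLocallyFiniteMeasure_add {α : Type*} [TopologicalSpace α] [MeasurableSpace α]
    (μ ν : Measure α) [IsLocallyFiniteMeasure μ] [IsLocallyFiniteMeasure ν] :
    IsLocallyFiniteMeasure (μ + ν) := by
  refine ⟨fun x => ?_⟩
  obtain ⟨s, hs, hμ⟩ := μ.finiteAt_nhds x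
  obtain ⟨t, ht, hν⟩ := ν.finiteAt_nhds x
  refine ⟨s ∩ t, Filter.inter_mem hs ht, ?_⟩
  rw [Measure.add_apply]
  exact ENNReal.add_lt_top.2 ⟨(measure_mono Set.inter_subset_left).trans_lt hμ,
    (measure_mono Set.inter_subset_right).trans_lt hν⟩

theorem ofReal_le_indicator_add {α : Type*} {B : Set α} {G H : α → ENNReal} {x : α} {y g t D : ℝ}
    (hD : 0 ≤ D) (hB : x ∈ B → y ≤ g + D * t) (hB' : x ∉ B → y ≤ D * t)
    (hG : ENNReal.ofReal g ≤ G x) (ht : ENNReal.ofReal t ≤ H x) :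
    ENNReal.ofReal y ≤ B.indicator G x + ENNReal.ofReal D * H x := by
  have h1 : ENNReal.ofReal (D * t) ≤ ENNReal.ofReal D * H x := by
    rw [ENNReal.ofReal_mul hD]
    gcongr
  by_cases hx : x ∈ B
  · rw [Set.indicator_of_mem hx]
    exact (ENNReal.ofReal_le_ofReal (hB hx)).trans
      (ENNReal.ofReal_add_le.trans (add_le_add hG h1))
  · rw [Set.indicator_of_notMem hx, zero_add]
    exact (ENNReal.ofReal_le_ofReal (hB' hx)).trans h1

set_option maxSynthPendingDepth 3
set_option linter.unusedSectionVars false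

variable {n : ℕ} {X : Type*} [MetricSpace X] [ChartedSpace (EuclideanSpace ℝ (Fin (n + 1))) X]
  [IsManifold (𝓡 (n + 1)) ∞ X] [RiemannianBundle (fun x : X => TangentSpace (𝓡 (n + 1)) x)]

/-- Cauchy–Schwarz for the sum of the squares of φ and √s, the hypothesis saying |∇√s|² ≤ k.
Squaring the cutoff is what bounds |∇u|²/u where φ degenerates. -/
theorem norm_mvfderiv_sq_add_sq_le {φ s : X → ℝ} {k : ℝ} {x : X}
    (hφ : MDifferentiableAt (𝓡 (n + 1)) 𝓘(ℝ, ℝ) φ x)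
    (hs : MDifferentiableAt (𝓡 (n + 1)) 𝓘(ℝ, ℝ) s x) (hφ0 : 0 ≤ φ x) (hs0 : 0 ≤ s x) (hk : 0 ≤ k)
    (h : ‖mvfderiv (𝓡 (n + 1)) s x‖ ^ 2 ≤ 4 * s x * k) :
    ‖mvfderiv (𝓡 (n + 1)) (fun y => φ y * φ y + s y) x‖ ^ 2
      ≤ 4 * (φ x * φ x + s x) * (‖mvfderiv (𝓡 (n + 1)) φ x‖ ^ 2 + k) := by
  have h1 : mvfderiv (𝓡 (n + 1)) (fun y => φ y * φ y + s y) x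
      = (φ x • mvfderiv (𝓡 (n + 1)) φ x + φ x • mvfderiv (𝓡 (n + 1)) φ x)
        + mvfderiv (𝓡 (n + 1)) s x :=
    (mvfderiv_fun_add (hφ.mul hφ) hs).trans
      (congrArg (· + mvfderiv (𝓡 (n + 1)) s x) (mvfderiv_fun_mul hφ hφ))
  set a := ‖mvfderiv (𝓡 (n + 1)) φ x‖ with ha
  set b := ‖mvfderiv (𝓡 (n + 1)) s x‖ with hb
  have ha0 : 0 ≤ a := norm_nonneg _
  have hb0 : 0 ≤ b := norm_nonneg _
  have h2 : ‖mvfderiv (𝓡 (n + 1)) (fun y => φ y * φ y + s y) x‖ ≤ 2 * φ x * a + b := by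
    rw [h1]
    refine (norm_add_le _ _).trans (add_le_add ((norm_add_le _ _).trans (le_of_eq ?_)) le_rfl)
    rw [norm_smul, Real.norm_of_nonneg hφ0]
    ring
  -- The cross term, by the inequality 4pq ≤ (p + q)² with p = φ²k and q = sa².
  have h3 : φ x * a * b ≤ φ x * φ x * k + s x * a ^ 2 := by
    refine (abs_le_of_sq_le_sq' ?_ (by positivity)).2
    have h4 : (φ x * a) ^ 2 * b ^ 2 ≤ (φ x * a) ^ 2 * (4 * s x * k) :=
      mul_le_mul_of_nonneg_left h (sq_nonneg _)
    nlinarith [sq_nonneg (φ x * φ x * k - s x * a ^ 2)]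
  have h5 := pow_le_pow_left₀ (norm_nonneg _) h2 2
  nlinarith

variable [IsContMDiffRiemannianBundle (𝓡 (n + 1)) ∞ (EuclideanSpace ℝ (Fin (n + 1)))
      (fun x : X => TangentSpace (𝓡 (n + 1)) x)] [IsRiemannianManifold (𝓡 (n + 1)) X]
  [SecondCountableTopology X] [Nonempty X] [MeasurableSpace X] [BorelSpace X]

/-- Every bound is a multiple of `v'`, because Z ≥ `v'` is the quantity divided by afterwards. -/
theorem exists_test_function {χ : ℝ → ℝ} {K : ℝ} (hχ : ContDiff ℝ ∞ χ)
    (hχK : ∀ t, 0 ≤ χ t ∧ χ t ≤ 1 ∧ |deriv χ t| ≤ K) (hχ1 : ∀ t ≤ 5 / 8, χ t = 1)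
    (hχ0 : ∀ t, 7 / 8 ≤ t → χ t = 0 ∧ deriv χ t = 0)
    {Ω : Set X} (hΩ : IsOpen Ω) (hΩs : HasSmoothBoundary n Ω) {β : X → ℝ}
    (hβ : ContinuousOn β (frontier Ω)) {S : X → ℝ} (hS : Continuous S) (x₀ : X)
    {r v v' b c σ : ℝ} (hr : 0 < r) (hv' : 0 < v') (hvv : v' ≤ v) (hvc : v ≤ c * v')
    (hV : riemannianVolume n X (Ω ∩ Metric.ball x₀ r) ≤ ENNReal.ofReal v)
    (hV' : ENNReal.ofReal v' ≤ riemannianVolume n X (Ω ∩ Metric.ball x₀ (r / 2)))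
    (hb0 : 0 ≤ b) (hbc : r ^ 2 * b ≤ c * v')
    (hb : ∫⁻ x in frontier Ω ∩ Metric.ball x₀ r, ENNReal.ofReal |β x| ∂hypersurfaceArea n X
      ≤ ENNReal.ofReal b)
    (hσ0 : 0 ≤ σ) (hσ : ∀ x ∈ Ω ∩ Metric.ball x₀ r, r ^ 2 * |S x| ≤ σ) :
    ∃ u : X → ℝ, ContMDiff (𝓡 (n + 1)) 𝓘(ℝ, ℝ) ∞ u ∧ (∀ x, 0 < u x) ∧
      (IntegrableOn u Ω (riemannianVolume n X) ∧ v' ≤ ∫ x in Ω, u x ∂riemannianVolume n X ∧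
        ∫ x in Ω, u x ∂riemannianVolume n X ≤ 2 * v) ∧
      (IntegrableOn (fun x => ‖mvfderiv (𝓡 (n + 1)) u x‖ ^ 2 / u x) Ω (riemannianVolume n X) ∧
        r ^ 2 * ∫ x in Ω, |‖mvfderiv (𝓡 (n + 1)) u x‖ ^ 2 / u x| ∂riemannianVolume n X
          ≤ (100 * K ^ 2 * c + 4) * v') ∧
      (IntegrableOn (fun x => S x * u x) Ω (riemannianVolume n X) ∧
        r ^ 2 * ∫ x in Ω, |S x * u x| ∂riemannianVolume n X ≤ (σ * c + 1) * v') ∧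
      (IntegrableOn (fun x => u x * Real.log (u x)) Ω (riemannianVolume n X) ∧
        ∫ x in Ω, |u x * Real.log (u x)| ∂riemannianVolume n X ≤ (2 * c + 2) * v') ∧
      (IntegrableOn (fun x => β x * u x) (frontier Ω) (hypersurfaceArea n X) ∧
        r ^ 2 * ∫ x in frontier Ω, |β x * u x| ∂hypersurfaceArea n X ≤ (c + 1) * v') := by
  have := isLocallyFiniteMeasure_hypersurfaceArea_restrict hΩ hΩs
  set ν := (hypersurfaceArea n X).restrict (frontier Ω) with hν
  set B := Metric.ball x₀ r with hBdef
  have hBm : MeasurableSet B := Metric.isOpen_ball.measurableSet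
  have hFm : MeasurableSet (frontier Ω) := isClosed_frontier.measurableSet
  have hv : 0 < v := hv'.trans_le hvv
  have hr2 : 0 < r ^ 2 := by positivity
  obtain ⟨φ, hφ, hφb, hφ1, hφ0⟩ := exists_contMDiff_cutoff_ball (n := n) hχ hχK hχ1 hχ0 x₀ hr
  -- Only `β` on the frontier is controlled; as the frontier is closed, the cut-off `A` is still
  -- locally bounded.
  let A : X → ℝ := fun x => |S x| + (frontier Ω).indicator (fun y => |β y|) x
  have hA : ∀ p, ∃ C, ∀ᶠ q in 𝓝 p, A q ≤ C := by
    intro p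
    have h1 : ∀ᶠ q in 𝓝 p, |S q| < |S p| + 1 := hS.abs.continuousAt.eventually_lt_const (by simp)
    by_cases hp : p ∈ frontier Ω
    · have h2 : ∀ᶠ q in 𝓝[frontier Ω] p, |β q| < |β p| + 1 :=
        (hβ p hp).abs.eventually_lt_const (by simp)
      rw [eventually_nhdsWithin_iff] at h2
      refine ⟨|S p| + 1 + (|β p| + 1), ?_⟩
      filter_upwards [h1, h2] with q hq1 hq2
      refine add_le_add hq1.le ?_
      by_cases hq : q ∈ frontier Ω
      · rw [Set.indicator_of_mem hq]; exact (hq2 hq).le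
      · rw [Set.indicator_of_notMem hq]; positivity
    · refine ⟨|S p| + 1 + 0, ?_⟩
      filter_upwards [h1, isClosed_frontier.isOpen_compl.mem_nhds hp] with q hq1 hq2
      refine add_le_add hq1.le (le_of_eq (Set.indicator_of_notMem hq2 _))
  obtain ⟨ε, hε, hεv, hεr⟩ : ∃ ε : ℝ, 0 < ε ∧ ε ≤ v' ∧ r ^ 2 * ε ≤ v' := by
    refine ⟨min v' (v' / r ^ 2), lt_min hv' (by positivity), min_le_left _ _, ?_⟩
    calc r ^ 2 * min v' (v' / r ^ 2) ≤ r ^ 2 * (v' / r ^ 2) := by gcongr; exact min_le_right _ _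
      _ = v' := by field_simp
  -- Using the sum of volume and boundary area lets a single s be small for both.
  have hfin : IsLocallyFiniteMeasure (riemannianVolume n X + ν) := isLocallyFiniteMeasure_add _ _
  obtain ⟨s, k, H, hs, hHm, hH, hsk⟩ :=
    exists_contMDiff_pos_small (n := n) (riemannianVolume n X + ν) hA hε
  rw [lintegral_add_measure] at hH
  have hHV : ∫⁻ x in Ω, H x ∂riemannianVolume n X ≤ ENNReal.ofReal ε :=
    (lintegral_mono' Measure.restrict_le_self le_rfl).trans (le_self_add.trans hH)
  have hHν : ∫⁻ x, H x ∂ν ≤ ENNReal.ofReal ε := le_add_self.trans hH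
  set T : X → ℝ := fun x => √(s x) + k x + A x * s x with hT
  have hTH : ∀ x, ENNReal.ofReal (T x) ≤ H x := fun x => (hsk x).2.2.2.2
  have hs0 : ∀ x, 0 < s x := fun x => (hsk x).1
  have hs1 : ∀ x, s x ≤ 1 := fun x => (hsk x).2.1
  have hk0 : ∀ x, 0 ≤ k x := fun x => (hsk x).2.2.1
  have hA0 : ∀ x, 0 ≤ A x := fun x =>
    add_nonneg (abs_nonneg _) (Set.indicator_nonneg (fun _ _ => abs_nonneg _) x)
  have hAs0 : ∀ x, 0 ≤ A x * s x := fun x => mul_nonneg (hA0 x) (hs0 x).le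
  have hsT : ∀ x, √(s x) ≤ T x := fun x => by
    simp only [hT]; linarith [hk0 x, hAs0 x]
  have hsT' : ∀ x, s x ≤ T x := fun x => by
    refine le_trans ?_ (hsT x)
    exact Real.le_sqrt_of_sq_le (by nlinarith [hs0 x, hs1 x])
  have hkT : ∀ x, k x ≤ T x := fun x => by
    simp only [hT]; linarith [Real.sqrt_nonneg (s x), hAs0 x]
  have hAT : ∀ x, A x * s x ≤ T x := fun x => by
    simp only [hT]; linarith [Real.sqrt_nonneg (s x), hk0 x]
  have hφsq : ∀ x, φ x * φ x ≤ 1 := fun x => by nlinarith [(hφb x).1, (hφb x).2.1]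
  let u : X → ℝ := fun x => φ x * φ x + s x
  have hu : ContMDiff (𝓡 (n + 1)) 𝓘(ℝ, ℝ) ∞ u := (hφ.mul hφ).add hs
  have hu0 : ∀ x, 0 < u x := fun x => by
    have := mul_self_nonneg (φ x)
    have := hs0 x
    simp only [u]; linarith
  have huB' : ∀ x ∉ B, u x = s x := fun x hx => by simp [u, (hφ0 x hx).1]
  have huB : ∀ x, u x ≤ 1 + s x := fun x => by simp only [u]; linarith [hφsq x]
  have hdu : ∀ x, ‖mvfderiv (𝓡 (n + 1)) u x‖ ^ 2 / u x
      ≤ 4 * (‖mvfderiv (𝓡 (n + 1)) φ x‖ ^ 2 + k x) := fun x => by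
    rw [div_le_iff₀ (hu0 x)]
    refine (norm_mvfderiv_sq_add_sq_le (hφ.contMDiffAt.mdifferentiableAt (by simp))
      (hs.contMDiffAt.mdifferentiableAt (by simp)) (hφb x).1 (hs0 x).le (hk0 x)
      (hsk x).2.2.2.1).trans (le_of_eq ?_)
    simp only [u]; ring
  have hum : Measurable u := hu.continuous.measurable
  have hGc : ∀ g : ℝ, 0 ≤ g → ∫⁻ _ in B, ENNReal.ofReal g ∂(riemannianVolume n X).restrict Ω
      ≤ ENNReal.ofReal (g * v) := fun g hg => by
    rw [lintegral_const, Measure.restrict_restrict hBm, Measure.restrict_apply_univ,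
      Set.inter_comm B, ENNReal.ofReal_mul hg]
    gcongr
  have I0 := integrable_and_integral_abs_le (m := (riemannianVolume n X).restrict Ω) (F := u)
    hum.aestronglyMeasurable hBm hHm (by positivity) hε.le zero_le_one (hGc 1 zero_le_one) hHV
    (Filter.Eventually.of_forall fun x => by
      rw [abs_of_pos (hu0 x)]
      exact ofReal_le_indicator_add zero_le_one
        (fun _ => by linarith [huB x, hsT' x]) (fun hx => by linarith [huB' x hx, hsT' x])
        le_rfl (hTH x))
  have I1 := integrable_and_integral_abs_le (m := (riemannianVolume n X).restrict Ω)
    (F := fun x => ‖mvfderiv (𝓡 (n + 1)) u x‖ ^ 2 / u x)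
    (((lowerSemicontinuous_norm_mvfderiv hu).measurable.pow_const 2).div
      hum).aestronglyMeasurable hBm hHm (by positivity) hε.le (by norm_num : (0 : ℝ) ≤ 4)
    (hGc (4 * (5 * K / r) ^ 2) (by positivity)) hHV
    (Filter.Eventually.of_forall fun x => by
      rw [abs_of_nonneg (div_nonneg (sq_nonneg _) (hu0 x).le)]
      refine ofReal_le_indicator_add (by norm_num) (fun _ => ?_) (fun hx => ?_) le_rfl (hTH x)
      · have := pow_le_pow_left₀ (norm_nonneg _) (hφb x).2.2 2
        linarith [hdu x, hkT x]
      · have := hdu x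
        rw [(hφ0 x hx).2, norm_zero] at this
        linarith [hkT x])
  have I2 := integrable_and_integral_abs_le (m := (riemannianVolume n X).restrict Ω)
    (F := fun x => S x * u x) (hS.measurable.mul hum).aestronglyMeasurable hBm hHm
    (by positivity) hε.le zero_le_one (hGc (σ / r ^ 2) (by positivity)) hHV
    ((ae_restrict_mem hΩ.measurableSet).mono fun x hxΩ => by
      rw [abs_mul, abs_of_pos (hu0 x)]
      have h1 : |S x| ≤ A x := by
        have : 0 ≤ (frontier Ω).indicator (fun y => |β y|) x :=
          Set.indicator_nonneg (fun _ _ => abs_nonneg _) x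
        simp only [A]; linarith
      have h2 := (mul_le_mul_of_nonneg_right h1 (hs0 x).le).trans (hAT x)
      refine ofReal_le_indicator_add zero_le_one (fun hx => ?_) (fun hx => ?_) le_rfl (hTH x)
      · have h3 : |S x| ≤ σ / r ^ 2 := by
          rw [le_div_iff₀ hr2, mul_comm]; exact hσ x ⟨hxΩ, hx⟩
        have h4 : |S x| * (φ x * φ x) ≤ |S x| := mul_le_of_le_one_right (abs_nonneg _) (hφsq x)
        simp only [u]
        linarith
      · rw [huB' x hx]; linarith)
  have I3 := integrable_and_integral_abs_le (m := (riemannianVolume n X).restrict Ω)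
    (F := fun x => u x * Real.log (u x))
    (hum.mul (Real.measurable_log.comp hum)).aestronglyMeasurable hBm hHm
    (by positivity) hε.le (by norm_num : (0 : ℝ) ≤ 2) (hGc 2 (by norm_num)) hHV
    (Filter.Eventually.of_forall fun x => by
      refine ofReal_le_indicator_add (by norm_num) (fun _ => ?_) (fun hx => ?_) le_rfl (hTH x)
      · have := abs_mul_log_le_two (hu0 x) ((huB x).trans (by linarith [hs1 x]))
        linarith [hsT' x, hs0 x]
      · rw [huB' x hx]
        have := abs_mul_log_le_sqrt (hs0 x) (hs1 x)
        linarith [hsT x])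
  have I4 := integrable_and_integral_abs_le (m := ν) (F := fun x => β x * u x)
    ((hβ.aestronglyMeasurable hFm).mul hum.aestronglyMeasurable) hBm hHm hb0 hε.le zero_le_one
    (G := fun x => ENNReal.ofReal |β x|)
    (by rw [hν, Measure.restrict_restrict hBm, Set.inter_comm]; exact hb) hHν
    ((ae_restrict_mem hFm).mono fun x hxF => by
      rw [abs_mul, abs_of_pos (hu0 x)]
      have h1 : |β x| ≤ A x := by
        simp only [A]
        rw [Set.indicator_of_mem hxF]
        linarith [abs_nonneg (S x)]
      have h2 := (mul_le_mul_of_nonneg_right h1 (hs0 x).le).trans (hAT x)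
      refine ofReal_le_indicator_add zero_le_one (fun hx => ?_) (fun hx => ?_) le_rfl (hTH x)
      · have h4 : |β x| * (φ x * φ x) ≤ |β x| := mul_le_of_le_one_right (abs_nonneg _) (hφsq x)
        simp only [u]
        linarith
      · rw [huB' x hx]; linarith)
  have hZ : v' ≤ ∫ x in Ω, u x ∂riemannianVolume n X := by
    rw [← ENNReal.ofReal_le_ofReal_iff (integral_nonneg fun x => (hu0 x).le),
      ofReal_integral_eq_lintegral_ofReal I0.1 (Filter.Eventually.of_forall fun x => (hu0 x).le)]
    refine hV'.trans ?_
    have hB'm : MeasurableSet (Metric.ball x₀ (r / 2)) := Metric.isOpen_ball.measurableSet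
    rw [Set.inter_comm, ← Measure.restrict_apply hB'm, ← lintegral_indicator_one hB'm]
    refine lintegral_mono (Set.indicator_le fun y hy => ?_)
    rw [Pi.one_apply, ← ENNReal.ofReal_one]
    refine ENNReal.ofReal_le_ofReal ?_
    simp only [u]
    rw [hφ1 y hy]
    linarith [hs0 y]
  refine ⟨u, hu, hu0, ⟨I0.1, hZ, ?_⟩, ⟨I1.1, ?_⟩, ⟨I2.1, ?_⟩, ⟨I3.1, ?_⟩, I4.1, ?_⟩
  · have h := I0.2
    simp only [abs_of_pos (hu0 _)] at h
    linarith
  · refine (mul_le_mul_of_nonneg_left I1.2 hr2.le).trans ?_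
    have h1 : r ^ 2 * (4 * (5 * K / r) ^ 2 * v + 4 * ε) = 100 * K ^ 2 * v + 4 * (r ^ 2 * ε) := by
      field_simp; ring
    rw [h1]
    nlinarith [sq_nonneg K, mul_le_mul_of_nonneg_left hvc (sq_nonneg K)]
  · refine (mul_le_mul_of_nonneg_left I2.2 hr2.le).trans ?_
    have h1 : r ^ 2 * (σ / r ^ 2 * v + 1 * ε) = σ * v + r ^ 2 * ε := by field_simp
    rw [h1]
    nlinarith [mul_le_mul_of_nonneg_left hvc hσ0]
  · exact I3.2.trans (by linarith)
  · refine (mul_le_mul_of_nonneg_left I4.2 hr2.le).trans ?_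
    nlinarith

end TestFunction

/-! ### The entropy of the test density. -/

section EntropyBound

set_option maxSynthPendingDepth 3
set_option linter.unusedSectionVars false

theorem integral_add_add_sub_sub {α : Type*} [MeasurableSpace α] {m : Measure α}
    {f₁ f₂ f₃ f₄ f₅ : α → ℝ} (h₁ : Integrable f₁ m) (h₂ : Integrable f₂ m) (h₃ : Integrable f₃ m)
    (h₄ : Integrable f₄ m) (h₅ : Integrable f₅ m) :
    ∫ x, (f₁ x + f₂ x + (f₃ x - f₄ x) - f₅ x) ∂m
      = ∫ x, f₁ x ∂m + ∫ x, f₂ x ∂m + (∫ x, f₃ x ∂m - ∫ x, f₄ x ∂m) - ∫ x, f₅ x ∂m := by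
  have h₁₂ : Integrable (fun x => f₁ x + f₂ x) m := h₁.add h₂
  have h₃₄ : Integrable (fun x => f₃ x - f₄ x) m := h₃.sub h₄
  have h₁₄ : Integrable (fun x => f₁ x + f₂ x + (f₃ x - f₄ x)) m := h₁₂.add h₃₄
  rw [integral_sub h₁₄ h₅, integral_add h₁₂ h₃₄, integral_add h₁ h₂, integral_sub h₃ h₄]

theorem entropyDensity_neg_log {n : ℕ} {X : Type*} {w : X → ℝ} {τ : ℝ} (hτ : 0 < τ) {x : X}
    (hw : 0 < w x) :
    entropyDensity n
      (fun x => -Real.log (w x) - ((n : ℝ) + 1) / 2 * Real.log (4 * Real.pi * τ)) τ x = w x := by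
  have h : 0 < 4 * Real.pi * τ := by positivity
  unfold entropyDensity
  rw [Real.rpow_def_of_pos h, neg_sub, sub_neg_eq_add, Real.exp_add, Real.exp_log hw, mul_comm,
    mul_comm (Real.log _) (_ / _), mul_div_assoc, div_self (Real.exp_ne_zero _), mul_one]

variable {n : ℕ} {X : Type*} [MetricSpace X] [ChartedSpace (EuclideanSpace ℝ (Fin (n + 1))) X]
  [IsManifold (𝓡 (n + 1)) ∞ X] [RiemannianBundle (fun x : X => TangentSpace (𝓡 (n + 1)) x)]
  [MeasurableSpace X] [BorelSpace X]

theorem norm_mvfderiv_neg_log_sq {u : X → ℝ} {Z L : ℝ} (hZ : 0 < Z) {x : X}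
    (hu : MDifferentiableAt (𝓡 (n + 1)) 𝓘(ℝ, ℝ) u x) (hu0 : 0 < u x) :
    ‖mvfderiv (𝓡 (n + 1)) (fun y => -Real.log (u y / Z) - L) x‖ ^ 2 * (u x / Z)
      = Z⁻¹ * (‖mvfderiv (𝓡 (n + 1)) u x‖ ^ 2 / u x) := by
  have hd : HasDerivAt (fun t : ℝ => -Real.log (t / Z) - L) (-(1 / Z / (u x / Z))) (u x) :=
    ((((hasDerivAt_id (u x)).div_const Z).log (div_pos hu0 hZ).ne').neg).sub_const L
  rw [mvfderiv_comp_real (g := fun t : ℝ => -Real.log (t / Z) - L) hd.differentiableAt hu,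
    hd.deriv, norm_smul, Real.norm_eq_abs, mul_pow, sq_abs]
  field_simp

/-- The admissible f is the one whose entropy density is u/Z. Then |∇f|² u/Z = Z⁻¹ |∇u|²/u, and the
constants in f integrate against total mass 1. -/
theorem entropyInf_le_of_test_function {S : X → ℝ} {Ω : Set X} {β u : X → ℝ} {τ Z : ℝ}
    (hτ : 0 < τ) (hu : ContMDiff (𝓡 (n + 1)) 𝓘(ℝ, ℝ) ∞ u) (hu0 : ∀ x, 0 < u x) (hZ : 0 < Z)
    (I0 : IntegrableOn u Ω (riemannianVolume n X))
    (hZu : ∫ x in Ω, u x ∂riemannianVolume n X = Z)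
    (I1 : IntegrableOn (fun x => ‖mvfderiv (𝓡 (n + 1)) u x‖ ^ 2 / u x) Ω (riemannianVolume n X))
    (I2 : IntegrableOn (fun x => S x * u x) Ω (riemannianVolume n X))
    (I3 : IntegrableOn (fun x => u x * Real.log (u x)) Ω (riemannianVolume n X))
    (I4 : IntegrableOn (fun x => β x * u x) (frontier Ω) (hypersurfaceArea n X)) :
    entropyInf n S Ω β τ ≤
      ((Z⁻¹ * (τ * (∫ x in Ω, ‖mvfderiv (𝓡 (n + 1)) u x‖ ^ 2 / u x ∂riemannianVolume n X)
          + τ * (∫ x in Ω, S x * u x ∂riemannianVolume n X)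
          - (∫ x in Ω, u x * Real.log (u x) ∂riemannianVolume n X)
          + 2 * (τ * ∫ x in frontier Ω, β x * u x ∂hypersurfaceArea n X))
        + Real.log Z - ((n : ℝ) + 1) / 2 * Real.log (4 * Real.pi * τ) - ((n : ℝ) + 1) : ℝ)
        : EReal) := by
  set L := ((n : ℝ) + 1) / 2 * Real.log (4 * Real.pi * τ) with hL
  let f : X → ℝ := fun x => -Real.log (u x / Z) - L
  have hden : ∀ x, entropyDensity n f τ x = Z⁻¹ * u x := fun x => by
    rw [← div_eq_inv_mul]
    exact entropyDensity_neg_log (w := fun x => u x / Z) hτ (div_pos (hu0 x) hZ)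
  have hden' : entropyDensity n f τ = fun x => Z⁻¹ * u x := funext hden
  have hgrad : ∀ x, ‖mvfderiv (𝓡 (n + 1)) f x‖ ^ 2 * entropyDensity n f τ x
      = Z⁻¹ * (‖mvfderiv (𝓡 (n + 1)) u x‖ ^ 2 / u x) := fun x => by
    rw [hden, ← div_eq_inv_mul]
    exact norm_mvfderiv_neg_log_sq hZ (hu.contMDiffAt.mdifferentiableAt (by simp)) (hu0 x)
  have hpot : ∀ x, f x * entropyDensity n f τ x
      = (Z⁻¹ * (Real.log Z - L)) * u x - Z⁻¹ * (u x * Real.log (u x)) := fun x => by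
    rw [hden]
    simp only [f]
    rw [Real.log_div (hu0 x).ne' hZ.ne']
    ring
  have hcurv : ∀ x, S x * entropyDensity n f τ x = Z⁻¹ * (S x * u x) := fun x => by
    rw [hden]; ring
  have hbdry : ∀ x, β x * entropyDensity n f τ x = Z⁻¹ * (β x * u x) := fun x => by
    rw [hden]; ring
  have hf : ContMDiff (𝓡 (n + 1)) 𝓘(ℝ, ℝ) ∞ f := fun x => by
    have h1 : ContDiffAt ℝ ∞ (fun t : ℝ => -Real.log (t / Z) - L) (u x) :=
      ((contDiffAt_id.div_const Z).log (div_pos (hu0 x) hZ).ne').neg.sub contDiffAt_const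
    exact h1.contMDiffAt.comp x hu.contMDiffAt
  have J1 := I1.const_mul Z⁻¹
  have J2 := I2.const_mul Z⁻¹
  have J3 := (I0.const_mul (Z⁻¹ * (Real.log Z - L))).sub (I3.const_mul Z⁻¹)
  have hadm : IsAdmissible n S Ω β τ f := by
    refine ⟨hf.contMDiffOn, ?_, ?_, ?_, ?_, ?_, ?_⟩
    · rw [hden']; exact I0.const_mul _
    · simp only [hgrad]; exact J1
    · simp only [hcurv]; exact J2
    · simp only [hpot]; exact J3
    · simp only [hbdry]; exact I4.const_mul _
    · rw [hden', integral_const_mul, hZu, inv_mul_cancel₀ hZ.ne']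
  refine (iInf₂_le f hadm).trans (EReal.coe_le_coe_iff.2 (le_of_eq ?_))
  have hW : ∀ x, (τ * (‖mvfderiv (𝓡 (n + 1)) f x‖ ^ 2 + S x) + f x - ((n : ℝ) + 1))
      * entropyDensity n f τ x
      = τ * (Z⁻¹ * (‖mvfderiv (𝓡 (n + 1)) u x‖ ^ 2 / u x)) + τ * (Z⁻¹ * (S x * u x))
        + ((Z⁻¹ * (Real.log Z - L)) * u x - Z⁻¹ * (u x * Real.log (u x)))
        - ((n : ℝ) + 1) * (Z⁻¹ * u x) := fun x => by
    rw [← hgrad, ← hcurv, ← hpot, ← hden]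
    ring
  unfold entropyFunctional
  simp only [hW, hbdry]
  rw [integral_add_add_sub_sub (J1.const_mul τ) (J2.const_mul τ) (I0.const_mul _)
    (I3.const_mul _) ((I0.const_mul _).const_mul _)]
  simp only [integral_const_mul, hZu]
  field_simp
  ring

variable [IsContMDiffRiemannianBundle (𝓡 (n + 1)) ∞ (EuclideanSpace ℝ (Fin (n + 1)))
      (fun x : X => TangentSpace (𝓡 (n + 1)) x)] [IsRiemannianManifold (𝓡 (n + 1)) X]
  [SecondCountableTopology X] [Nonempty X]

theorem entropyInf_le {χ : ℝ → ℝ} {K : ℝ} (hχ : ContDiff ℝ ∞ χ)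
    (hχK : ∀ t, 0 ≤ χ t ∧ χ t ≤ 1 ∧ |deriv χ t| ≤ K) (hχ1 : ∀ t ≤ 5 / 8, χ t = 1)
    (hχ0 : ∀ t, 7 / 8 ≤ t → χ t = 0 ∧ deriv χ t = 0)
    {Ω : Set X} (hΩ : IsOpen Ω) (hΩs : HasSmoothBoundary n Ω) {β : X → ℝ}
    (hβ : ContinuousOn β (frontier Ω)) {S : X → ℝ} (hS : Continuous S) (x₀ : X)
    {r v v' b c σ : ℝ} (hr : 0 < r) (hv' : 0 < v') (hvv : v' ≤ v) (hvc : v ≤ c * v')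
    (hV : riemannianVolume n X (Ω ∩ Metric.ball x₀ r) ≤ ENNReal.ofReal v)
    (hV' : ENNReal.ofReal v' ≤ riemannianVolume n X (Ω ∩ Metric.ball x₀ (r / 2)))
    (hb0 : 0 ≤ b) (hbc : r ^ 2 * b ≤ c * v')
    (hb : ∫⁻ x in frontier Ω ∩ Metric.ball x₀ r, ENNReal.ofReal |β x| ∂hypersurfaceArea n X
      ≤ ENNReal.ofReal b)
    (hσ0 : 0 ≤ σ) (hσ : ∀ x ∈ Ω ∩ Metric.ball x₀ r, r ^ 2 * |S x| ≤ σ) :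
    entropyInf n S Ω β (r ^ 2) ≤
      ((100 * K ^ 2 * c + σ * c + 4 * c + 10 + Real.log v - ((n : ℝ) + 1) * Real.log r : ℝ)
        : EReal) := by
  obtain ⟨u, hu, hu0, ⟨I0, hZ1, hZ2⟩, ⟨I1, b1⟩, ⟨I2, b2⟩, ⟨I3, b3⟩, I4, b4⟩ :=
    exists_test_function hχ hχK hχ1 hχ0 hΩ hΩs hβ hS x₀ hr hv' hvv hvc hV hV' hb0 hbc hb hσ0 hσ
  have hr2 : 0 < r ^ 2 := by positivity
  have hv : 0 < v := hv'.trans_le hvv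
  have hc : 0 < c := pos_of_mul_pos_left (hv.trans_le hvc) hv'.le
  have hZ : 0 < ∫ x in Ω, u x ∂riemannianVolume n X := hv'.trans_le hZ1
  refine (entropyInf_le_of_test_function hr2 hu hu0 hZ I0 rfl I1 I2 I3 I4).trans
    (EReal.coe_le_coe_iff.2 ?_)
  set Z := ∫ x in Ω, u x ∂riemannianVolume n X
  have e1 := mul_le_mul_of_nonneg_left ((le_abs_self _).trans abs_integral_le_integral_abs :
    ∫ x in Ω, ‖mvfderiv (𝓡 (n + 1)) u x‖ ^ 2 / u x ∂riemannianVolume n X ≤ _) hr2.le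
  have e2 := mul_le_mul_of_nonneg_left ((le_abs_self _).trans abs_integral_le_integral_abs :
    ∫ x in Ω, S x * u x ∂riemannianVolume n X ≤ _) hr2.le
  have e3 := (neg_le_abs _).trans (abs_integral_le_integral_abs (f := fun x =>
    u x * Real.log (u x)) (μ := (riemannianVolume n X).restrict Ω))
  have e4 := mul_le_mul_of_nonneg_left ((le_abs_self _).trans abs_integral_le_integral_abs :
    ∫ x in frontier Ω, β x * u x ∂hypersurfaceArea n X ≤ _) hr2.le
  -- Sum of the four bounds of `exists_test_function`, the boundary one counted twice: 4 + 1 + 2 + 2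
  -- = 9 and 2c + 2c = 4c.
  have hC : 0 ≤ 100 * K ^ 2 * c + σ * c + 4 * c + 9 := by positivity
  have hmain : Z⁻¹ * (r ^ 2 * (∫ x in Ω, ‖mvfderiv (𝓡 (n + 1)) u x‖ ^ 2 / u x
          ∂riemannianVolume n X)
        + r ^ 2 * (∫ x in Ω, S x * u x ∂riemannianVolume n X)
        - (∫ x in Ω, u x * Real.log (u x) ∂riemannianVolume n X)
        + 2 * (r ^ 2 * ∫ x in frontier Ω, β x * u x ∂hypersurfaceArea n X))
      ≤ 100 * K ^ 2 * c + σ * c + 4 * c + 9 := by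
    rw [inv_mul_le_iff₀ hZ]
    refine le_trans ?_ (mul_le_mul_of_nonneg_right hZ1 hC)
    linarith
  -- Since Z ≤ 2v and log 2 < 1; this turns 9 into 10.
  have hlogZ : Real.log Z ≤ Real.log v + 1 := by
    refine (Real.log_le_log hZ hZ2).trans ?_
    rw [Real.log_mul two_ne_zero hv.ne']
    linarith [Real.log_two_lt_d9]
  have hlogr : Real.log (4 * Real.pi * r ^ 2) = Real.log (4 * Real.pi) + 2 * Real.log r := by
    rw [Real.log_mul (by positivity) hr2.ne', Real.log_pow]
    norm_num
  have hpi : 0 ≤ Real.log (4 * Real.pi) := Real.log_nonneg (by linarith [Real.pi_gt_three])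
  have hn : (0 : ℝ) ≤ n := n.cast_nonneg
  rw [hlogr]
  -- The leftover terms -(n+1)/2 · log (4π) and -(n+1) are nonpositive and are dropped.
  nlinarith [mul_nonneg (by positivity : (0 : ℝ) ≤ ((n : ℝ) + 1) / 2) hpi]

end EntropyBound

/-! ### The noncollapsing estimate. -/

theorem mainTheorem6 (n : ℕ) (c₀ c₁ c₂ : ℝ) :
    ∃ κ : ℝ, 0 < κ ∧
      ∀ (X : Type*) [MetricSpace X] [CompleteSpace X] [SecondCountableTopology X]
        [MeasurableSpace X] [BorelSpace X]
        [ChartedSpace (EuclideanSpace ℝ (Fin (n + 1))) X] [IsManifold (𝓡 (n + 1)) ∞ X]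
        [RiemannianBundle (fun x : X => TangentSpace (𝓡 (n + 1)) x)]
        [IsContMDiffRiemannianBundle (𝓡 (n + 1)) ∞ (EuclideanSpace ℝ (Fin (n + 1)))
          (fun x : X => TangentSpace (𝓡 (n + 1)) x)]
        [IsRiemannianManifold (𝓡 (n + 1)) X]
        (Ω : Set X) (β : X → ℝ) (x₀ : X) (r : ℝ),
        IsOpen Ω → HasSmoothBoundary n Ω →
        ContMDiffOn (𝓡 (n + 1)) 𝓘(ℝ, ℝ) ∞ β (frontier Ω) →
        0 < r →
        (((-c₀ : ℝ) : EReal) ≤ muMetric n Ω β (r ^ 2) ∨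
          ((-c₀ : ℝ) : EReal) ≤ muFixed n Ω β (r ^ 2)) →
        0 < riemannianVolume n X (Ω ∩ Metric.ball x₀ (r / 2)) →
        (riemannianVolume n X (Ω ∩ Metric.ball x₀ r) +
            ENNReal.ofReal (r ^ 2) *
              ∫⁻ x in frontier Ω ∩ Metric.ball x₀ r, ENNReal.ofReal |β x| ∂hypersurfaceArea n X) /
          riemannianVolume n X (Ω ∩ Metric.ball x₀ (r / 2)) ≤ ENNReal.ofReal c₁ →
        (∀ x ∈ Ω ∩ Metric.ball x₀ r, r ^ 2 * riemannNorm n x ≤ c₂) →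
        ENNReal.ofReal κ ≤
          riemannianVolume n X (Ω ∩ Metric.ball x₀ r) / ENNReal.ofReal (r ^ (n + 1)) := by

  obtain ⟨χ, K, hχ, hK0, hχK, hχ1, hχ0⟩ := exists_smooth_cutoff
  set σ : ℝ := ((n : ℝ) + 1) ^ 2 * max c₂ 0 with hσdef
  have hσ0 : 0 ≤ σ := by positivity
  set C : ℝ := 100 * K ^ 2 * c₁ + σ * c₁ + 4 * c₁ + 10 with hC
  -- Obtained by solving -c₀ ≤ C + log (V/r^{n+1}) for the volume ratio.
  refine ⟨Real.exp (-c₀ - C), Real.exp_pos _, ?_⟩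
  intro X _ _ _ _ _ _ _ _ _ _ Ω β x₀ r hΩ hΩs hβ hr hμ hV' hratio hRm
  have : Nonempty X := ⟨x₀⟩
  have hrn : ENNReal.ofReal (r ^ (n + 1)) ≠ 0 := by
    rw [Ne, ENNReal.ofReal_eq_zero, not_le]; positivity
  set V := riemannianVolume n X (Ω ∩ Metric.ball x₀ r) with hVdef
  set V' := riemannianVolume n X (Ω ∩ Metric.ball x₀ (r / 2)) with hVdef'
  set b := ∫⁻ x in frontier Ω ∩ Metric.ball x₀ r, ENNReal.ofReal |β x| ∂hypersurfaceArea n X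
    with hbdef
  have hle : V' ≤ V := measure_mono
    (Set.inter_subset_inter_right _ (Metric.ball_subset_ball (by linarith)))
  rcases eq_or_ne V ⊤ with hVtop | hVtop
  · rw [hVtop, ENNReal.top_div_of_ne_top ENNReal.ofReal_ne_top]
    exact le_top
  have hVtop' : V' ≠ ⊤ := ne_top_of_le_ne_top hVtop hle
  rw [ENNReal.div_le_iff hV'.ne' hVtop'] at hratio
  have hsum : V + ENNReal.ofReal (r ^ 2) * b ≠ ⊤ :=
    ne_top_of_le_ne_top (ENNReal.mul_ne_top ENNReal.ofReal_ne_top hVtop') hratio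
  have hbtop : b ≠ ⊤ := by
    intro h
    refine hsum ?_
    rw [h, ENNReal.mul_top (by rw [Ne, ENNReal.ofReal_eq_zero, not_le]; positivity), add_top]
  have hv' : 0 < V'.toReal := ENNReal.toReal_pos hV'.ne' hVtop'
  have hvv : V'.toReal ≤ V.toReal := ENNReal.toReal_mono hVtop hle
  have hv : 0 < V.toReal := hv'.trans_le hvv
  have hratio' : V.toReal + r ^ 2 * b.toReal ≤ max c₁ 0 * V'.toReal := by
    have h := ENNReal.toReal_mono (ENNReal.mul_ne_top ENNReal.ofReal_ne_top hVtop') hratio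
    rwa [ENNReal.toReal_add hVtop (ENNReal.mul_ne_top ENNReal.ofReal_ne_top hbtop),
      ENNReal.toReal_mul, ENNReal.toReal_ofReal (sq_nonneg r), ENNReal.toReal_mul,
      ENNReal.toReal_ofReal'] at h
  have hb0 : 0 ≤ b.toReal := ENNReal.toReal_nonneg
  have hrb : 0 ≤ r ^ 2 * b.toReal := mul_nonneg (sq_nonneg r) hb0
  -- `ENNReal.ofReal c₁` truncates at 0; a negative c₁ would force V = 0.
  have hc₁ : max c₁ 0 = c₁ := by
    refine max_eq_left (le_of_not_gt fun h => ?_)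
    rw [max_eq_right h.le, zero_mul] at hratio'
    linarith
  rw [hc₁] at hratio'
  have hσ : ∀ x ∈ Ω ∩ Metric.ball x₀ r, r ^ 2 * |scalarCurvature n x| ≤ σ := by
    intro x hx
    calc r ^ 2 * |scalarCurvature n x| ≤ r ^ 2 * (((n : ℝ) + 1) ^ 2 * riemannNorm n x) :=
          mul_le_mul_of_nonneg_left (abs_scalarCurvature_le x) (sq_nonneg r)
      _ = ((n : ℝ) + 1) ^ 2 * (r ^ 2 * riemannNorm n x) := by ring
      _ ≤ σ := mul_le_mul_of_nonneg_left ((hRm x hx).trans (le_max_left _ _)) (sq_nonneg _)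
  -- A general S treats both entropies at once, with S = R and with S = 0.
  have hbound : ∀ S : X → ℝ, Continuous S → (∀ x ∈ Ω ∩ Metric.ball x₀ r, r ^ 2 * |S x| ≤ σ) →
      entropyInf n S Ω β (r ^ 2) ≤
        ((C + Real.log V.toReal - ((n : ℝ) + 1) * Real.log r : ℝ) : EReal) :=
    fun S hS hSσ => entropyInf_le hχ hχK hχ1 hχ0 hΩ hΩs hβ.continuousOn hS x₀ hr hv' hvv
      (by linarith) (ENNReal.ofReal_toReal hVtop).ge (ENNReal.ofReal_toReal hVtop').le hb0
      (by linarith) (ENNReal.ofReal_toReal hbtop).ge hσ0 hSσ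
  have hmain : -c₀ ≤ C + Real.log V.toReal - ((n : ℝ) + 1) * Real.log r := by
    rw [← EReal.coe_le_coe_iff]
    rcases hμ with hμ | hμ
    · exact hμ.trans (hbound _ continuous_scalarCurvature hσ)
    · exact hμ.trans (hbound _ continuous_const fun x _ => by simpa using hσ0)
  rw [ENNReal.le_div_iff_mul_le (Or.inl hrn) (Or.inl ENNReal.ofReal_ne_top),
    ← ENNReal.ofReal_mul (Real.exp_pos _).le, ← ENNReal.ofReal_toReal hVtop]
  refine ENNReal.ofReal_le_ofReal ?_
  rw [← Real.log_le_log_iff (by positivity) hv, Real.log_mul (Real.exp_ne_zero _) (by positivity),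
    Real.log_exp, Real.log_pow]
  push_cast
  linarith
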